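/- **Setting.** Let $m,n\ge 1$ be integers, let $\mathcal H$ be a complex Hilbert space and let $\mathbb F_n^+$ be the unital free semigroup on generators $g_1,\dots,g_n$, with unit $g_0$; $|\alpha|$ is the length and $\tilde\alpha$ the reverse of a word $\alpha$. For an $n$-tuple $X=(X_1,\dots,X_n)$ of operators and $\alpha=g_{i_1}\cdots g_{i_k}$ put $X_\alpha:=X_{i_1}\cdots X_{i_k}$, $X_{g_0}:=I$. Let $f=\sum_{\alpha}a_\alpha X_\alpha$ be a positive regular free holomorphic function: $a_\alpha\ge 0$, $a_{g_0}=0$, $a_{g_i}>0$ for $i=1,\dots,n$, and for some $\rho>0$ the series $\sum_{k}\sum_{|\alpha|=k}a_\alpha X_\alpha$ converges in norm for all $X\in B(\mathcal H)^n$ with $\|\sum_i X_iX_i^*\|<\rho$. Put $b_{g_0}:=1$ and $$b_\alpha:=\sum_{j=1}^{|\alpha|}\ \sum_{\gamma_1\cdots\gamma_j=\alpha,\ |\gamma_i|\ge1}a_{\gamma_1}\cdots a_{\gamma_j}\binom{j+m-1}{m-1}\qquad(|\alpha|\ge 1).$$ On the full Fock space $F^2(H_n)$ with orthonormal basis $(e_\alpha)_{\alpha\in\mathbb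 F_n^+}$ and vacuum vector $1=e_{g_0}$, let $W_i$ and $\Lambda_i$ be the bounded operators with $$W_ie_\alpha=\sqrt{b_\alpha/b_{g_i\alpha}}\;e_{g_i\alpha},\qquad \Lambda_ie_\alpha=\sqrt{b_\alpha/b_{\alpha g_i}}\;e_{\alpha g_i}.$$ Let $\mathcal S:=\overline{\mathrm{span}}\{W_\alpha W_\beta^*:\alpha,\beta\in\mathbb F_n^+\}$ (norm closure), and let $\mathcal A_n(\mathbf D_f^m)\subset\mathcal S$ be the norm closed algebra generated by $W_1,\dots,W_n$ and the identity. For $T\in B(\mathcal H)^n$ put $\Phi_{f,T}(Y):=\sum_{|\alpha|\ge1}a_\alpha T_\alpha YT_\alpha^*$ (weak operator topology). The noncommutative domain $\mathbf D_f^m(\mathcal H)$ is the set of all $T\in B(\mathcal H)^n$ for which the series $\Phi_{f,T}(I)$ converges and $(\mathrm{id}-\Phi_{f,T})^k(I)\ge 0$ for $1\le k\le m$; for such $T$ put $\Delta_T:=[(\mathrm{id}-\Phi_{f,T})^m(I)]^{1/2}$. $T\in\mathbf D_f^m(\mathcal H)$ has the *radial property* if there is $\delta\in(0,1)$ with $rT\in\mathbf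 D_f^m(\mathcal H)$ for all $r\in(\delta,1)$; it is *pure* if $\Phi_{f,T}^k(I)\to0$ strongly as $k\to\infty$. For $T\in\mathbf D_f^m(\mathcal H)$ with $r_f(T):=\lim_k\|\Phi_{f,T}^k(I)\|^{1/2k}<1$, the Berezin transform $\mathbf B_T:B(F^2(H_n))\to B(\mathcal H)$ is given by $$\langle\mathbf B_T[g]x,y\rangle:=\Big\langle\Big(I-\sum_{|\alpha|\ge1}a_{\tilde\alpha}\Lambda_\alpha^*\otimes T_{\tilde\alpha}\Big)^{-m}(g\otimes\Delta_T^2)\Big(I-\sum_{|\alpha|\ge1}a_{\tilde\alpha}\Lambda_\alpha\otimes T_{\tilde\alpha}^*\Big)^{-m}(1\otimes x),\,1\otimes y\Big\rangle .$$ For $T\in\mathbf D_f^m(\mathcal H)$ the extended Berezin transform is $\widetilde{\mathbf B}_T[g]:=K_T^*(g\otimes I_{\mathcal H})K_T$, where $K_T:\mathcal H\to F^2(H_n)\otimes\mathcal H$, $K_Th:=\sum_\alpha\sqrt{b_\alpha}\,e_\alpha\otimes\Delta_TT_\alpha^*h$. **Theorem.** Let $T\in\mathbf D_f^m(\mathcal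 H)$ have the radial property. Then for all $r<1$ sufficiently close to $1$ the transform $\mathbf B_{rT}$ is defined (that is, $rT\in\mathbf D_f^m(\mathcal H)$, $r_f(rT)<1$, and the series converge and the inverses exist), and there is a unital completely contractive linear map $\Psi:\mathcal S\to B(\mathcal H)$ such that $$\Psi(g)=\lim_{r\to1^-}\mathbf B_{rT}[g],\qquad g\in\mathcal S,$$ in the norm topology of $B(\mathcal H)$, and $\Psi(W_\alpha W_\beta^*)=T_\alpha T_\beta^*$ for all $\alpha,\beta\in\mathbb F_n^+$. In particular, the restriction of $\Psi$ to $\mathcal A_n(\mathbf D_f^m)$ is a completely contractive (unital algebra) homomorphism. If, in addition, $T$ is pure, then the series defining $K_T$ converges and $\lim_{r\to1^-}\mathbf B_{rT}[g]=\widetilde{\mathbf B}_T[g]$ in norm for every $g\in\mathcal S$. -/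

import Mathlib

open Filter Topology
open scoped TensorProduct

noncomputable section

namespace NCDomain

/-! ### Words, monomials and positive regular free power series -/

/-- The monomial `X_α = X_{i_1} ⋯ X_{i_k}` for the word `α = g_{i_1} ⋯ g_{i_k}` of the free semigroup
on `n` generators. Words are lists of letters, the product of words is concatenation, the unit
is `[]`, and the reverse of `α` is `α.reverse`. -/
def mono {n : ℕ} {A : Type*} [Monoid A] (X : Fin n → A) (α : List (Fin n)) : A :=
  (α.map X).prod

/-- Coefficients of a positive regular formal power series `f = ∑ a_α X_α` in `n` noncommuting
variables: `a_α ≥ 0`, the constant term is `0`, and `a_{g_i} > 0` for every generator. -/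
structure PosRegular (n : ℕ) where
  coeff : List (Fin n) → ℝ
  coeff_nonneg : ∀ α, 0 ≤ coeff α
  coeff_nil : coeff [] = 0
  coeff_letter : ∀ i, 0 < coeff [i]

/-- `f` is a free holomorphic function on the ball `{X : ‖∑ X_i X_i^*‖ < ρ}` of `B(H)^n`:
the series `∑_k ∑_{|α|=k} a_α X_α` converges in norm at every point of the ball. -/
def PosRegular.IsFreeHolomorphicOn {n : ℕ} (f : PosRegular n) (H : Type*) [NormedAddCommGroup H]
    [InnerProductSpace ℂ H] [CompleteSpace H] (ρ : ℝ) : Prop :=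
  ∀ X : Fin n → H →L[ℂ] H, ‖∑ i, X i * star (X i)‖ < ρ →
    ∃ L : H →L[ℂ] H, Tendsto (fun N : ℕ => ∑ k ∈ Finset.range N, ∑ s : Fin k → Fin n,
      (f.coeff (List.ofFn s) : ℂ) • mono X (List.ofFn s)) atTop (𝓝 L)

/-- The coefficient
`b_α^{(m)} = ∑_j ∑_{γ_1 ⋯ γ_j = α, |γ_i| ≥ 1} a_{γ_1} ⋯ a_{γ_j} * C(j + m - 1, m - 1)`.
The factorizations of `α` into nonempty words correspond to the compositions of `|α|`;
for the empty word the only one is the empty factorization, so that the value is `1`. -/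
def PosRegular.b {n : ℕ} (f : PosRegular n) (m : ℕ) (α : List (Fin n)) : ℝ :=
  ∑ c : Composition α.length,
    ((α.splitWrtComposition c).map f.coeff).prod * ((c.length + m - 1).choose (m - 1) : ℝ)

section Weights

variable {n : ℕ} (f : PosRegular n) (m : ℕ)

theorem PosRegular.term_nonneg (α : List (Fin n)) (c : Composition α.length) :
    0 ≤ ((α.splitWrtComposition c).map f.coeff).prod *
      ((c.length + m - 1).choose (m - 1) : ℝ) := by
  refine mul_nonneg (List.prod_nonneg ?_) (Nat.cast_nonneg _)
  intro x hx
  obtain ⟨γ, -, rfl⟩ := List.mem_map.1 hx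
  exact f.coeff_nonneg γ

theorem PosRegular.b_nonneg (α : List (Fin n)) : 0 ≤ f.b m α :=
  Finset.sum_nonneg fun c _ => f.term_nonneg m α c

theorem PosRegular.b_cons_ge (i : Fin n) (α : List (Fin n)) :
    f.coeff [i] * f.b m α ≤ f.b m (i :: α) := by
  let e : Composition α.length → Composition (i :: α).length := fun c =>
    ⟨1 :: c.blocks, by
      intro k hk
      rcases List.mem_cons.1 hk with rfl | hk
      · exact one_pos
      · exact c.blocks_pos hk, by simp [c.blocks_sum, add_comm]⟩
  have he : Function.Injective e := by
    intro c d h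
    have h1 := congrArg Composition.blocks h
    exact Composition.ext (List.cons.inj h1).2
  unfold PosRegular.b
  rw [Finset.mul_sum]
  calc _ ≤ ∑ c : Composition α.length, (((i :: α).splitWrtComposition (e c)).map f.coeff).prod *
          (((e c).length + m - 1).choose (m - 1) : ℝ) := by
        refine Finset.sum_le_sum fun c _ => ?_
        have h1 : (i :: α).splitWrtComposition (e c) = [i] :: α.splitWrtComposition c := by
          simp [e, List.splitWrtComposition, List.splitWrtCompositionAux_cons]
        have h2 : (e c).length = c.length + 1 := by simp [e, Composition.length]
        rw [h1, h2, List.map_cons, List.prod_cons, ← mul_assoc]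
        refine mul_le_mul_of_nonneg_left ?_ (mul_nonneg (f.coeff_nonneg _) (List.prod_nonneg ?_))
        · exact_mod_cast Nat.choose_le_choose _ (by omega)
        · intro x hx
          obtain ⟨γ, -, rfl⟩ := List.mem_map.1 hx
          exact f.coeff_nonneg γ
    _ = ∑ d ∈ Finset.univ.map ⟨e, he⟩, (((i :: α).splitWrtComposition d).map f.coeff).prod *
          ((d.length + m - 1).choose (m - 1) : ℝ) := by
        rw [Finset.sum_map]; rfl
    _ ≤ _ := Finset.sum_le_sum_of_subset_of_nonneg (Finset.subset_univ _)
        fun d _ _ => f.term_nonneg m _ d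

theorem splitAux_snoc (i : Fin n) : ∀ (ns : List ℕ) (α : List (Fin n)), ns.sum = α.length →
    (α ++ [i]).splitWrtCompositionAux (ns ++ [1]) = α.splitWrtCompositionAux ns ++ [[i]]
  | [], α, h => by
    have : α = [] := List.length_eq_zero_iff.1 (by simpa using h.symm)
    subst this
    simp [List.splitWrtCompositionAux]
  | k :: ns, α, h => by
    have hk : k ≤ α.length := by simp at h; omega
    have h2 : ns.sum = (α.drop k).length := by simp at h ⊢; omega
    rw [List.cons_append, List.splitWrtCompositionAux_cons, List.splitWrtCompositionAux_cons,
      List.take_append_of_le_length hk, List.drop_append_of_le_length hk,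
      splitAux_snoc i ns _ h2, List.cons_append]

theorem PosRegular.b_snoc_ge (i : Fin n) (α : List (Fin n)) :
    f.coeff [i] * f.b m α ≤ f.b m (α ++ [i]) := by
  let e : Composition α.length → Composition (α ++ [i]).length := fun c =>
    ⟨c.blocks ++ [1], by
      intro k hk
      rcases List.mem_append.1 hk with hk | hk
      · exact c.blocks_pos hk
      · rw [List.mem_singleton.1 hk]; exact one_pos, by simp [c.blocks_sum]⟩
  have he : Function.Injective e := by
    intro c d h
    have h1 := congrArg Composition.blocks h
    exact Composition.ext (List.append_cancel_right h1)
  unfold PosRegular.b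
  rw [Finset.mul_sum]
  calc _ ≤ ∑ c : Composition α.length, (((α ++ [i]).splitWrtComposition (e c)).map f.coeff).prod *
          (((e c).length + m - 1).choose (m - 1) : ℝ) := by
        refine Finset.sum_le_sum fun c _ => ?_
        have h1 : (α ++ [i]).splitWrtComposition (e c) = α.splitWrtComposition c ++ [[i]] :=
          splitAux_snoc i c.blocks α c.blocks_sum
        have h2 : (e c).length = c.length + 1 := by simp [e, Composition.length]
        rw [h1, h2, List.map_append, List.prod_append, List.map_singleton, List.prod_singleton,
          ← mul_assoc, mul_comm (f.coeff [i])]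
        refine mul_le_mul_of_nonneg_left ?_ (mul_nonneg (List.prod_nonneg ?_) (f.coeff_nonneg _))
        · exact_mod_cast Nat.choose_le_choose _ (by omega)
        · intro x hx
          obtain ⟨γ, -, rfl⟩ := List.mem_map.1 hx
          exact f.coeff_nonneg γ
    _ = ∑ d ∈ Finset.univ.map ⟨e, he⟩, (((α ++ [i]).splitWrtComposition d).map f.coeff).prod *
          ((d.length + m - 1).choose (m - 1) : ℝ) := by
        rw [Finset.sum_map]; rfl
    _ ≤ _ := Finset.sum_le_sum_of_subset_of_nonneg (Finset.subset_univ _)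
        fun d _ _ => f.term_nonneg m _ d

theorem sqrt_ratio_le {a x y : ℝ} (ha : 0 < a) (hx : 0 ≤ x) (h : a * x ≤ y) :
    |√(x / y)| ≤ 1 / √a := by
  rw [abs_of_nonneg (Real.sqrt_nonneg _), one_div, ← Real.sqrt_inv]
  refine Real.sqrt_le_sqrt ?_
  rcases (mul_nonneg ha.le hx).trans h |>.eq_or_lt with hy | hy
  · rw [← hy, div_zero]; exact (inv_pos.2 ha).le
  · rw [div_le_iff₀ hy, inv_mul_eq_div, le_div_iff₀ ha]; linarith

end Weights

/-! ### The full Fock space and the weighted creation operators -/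

/-- The full Fock space `F²(H_n)` on `n` generators, as `ℓ²` of the set of words: the basis vector
`e_α = e_{i_1} ⊗ ⋯ ⊗ e_{i_k}` of `H_n^{⊗ k}` is indexed by the word `α = g_{i_1} ⋯ g_{i_k}`. -/
abbrev Fock (n : ℕ) : Type := lp (fun _ : List (Fin n) => ℂ) 2

/-- The canonical orthonormal basis vector `e_α`; `e_[]` is the vacuum vector `1`. -/
def e {n : ℕ} (α : List (Fin n)) : Fock n := lp.single 2 α (1 : ℂ)

section Creation

variable {n : ℕ}

theorem orthonormal_e : Orthonormal ℂ (e : List (Fin n) → Fock n) := by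
  rw [orthonormal_iff_ite]
  intro α β
  rw [e, e, lp.inner_single_left, lp.single_apply, Pi.single_apply]
  split_ifs <;> simp

/-- The isometry `e_α ↦ e_{σ α}` for an injective map `σ` of the set of words. -/
def permIsometry (σ : List (Fin n) → List (Fin n)) (hσ : Function.Injective σ) :
    Fock n →L[ℂ] Fock n :=
  ((orthonormal_e.comp σ hσ).orthogonalFamily.linearIsometry).toContinuousLinearMap

/-- The diagonal operator `e_α ↦ w_α e_α` for a bounded family of real weights `w`. -/
def diagOp (w : List (Fin n) → ℝ) (C : ℝ) (hC : ∀ α, |w α| ≤ C) : Fock n →L[ℂ] Fock n :=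
  have hle : ∀ (x : Fock n) (α : List (Fin n)), ‖(w α : ℂ) * x α‖ ≤ ‖((C : ℂ) • x) α‖ := by
    intro x α
    have h0 : 0 ≤ C := (abs_nonneg _).trans (hC α)
    rw [lp.coeFn_smul, Pi.smul_apply, norm_smul, norm_mul]
    refine mul_le_mul_of_nonneg_right ?_ (norm_nonneg _)
    simpa [abs_of_nonneg h0] using hC α
  LinearMap.mkContinuous
    { toFun := fun x => ⟨fun α => (w α : ℂ) * x α, (lp.memℓp ((C : ℂ) • x)).mono' (hle x)⟩
      map_add' := fun x y => by ext α; exact mul_add _ _ _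
      map_smul' := fun c x => by ext α; simp; ring }
    C (fun x => by
      have h0 : 0 ≤ C := (abs_nonneg _).trans (hC [])
      refine (lp.norm_mono (p := 2) (y := (C : ℂ) • x) (by norm_num) (hle x)).trans ?_
      rw [norm_smul]
      simp [abs_of_nonneg h0])

theorem permIsometry_e (σ : List (Fin n) → List (Fin n)) (hσ : Function.Injective σ)
    (α : List (Fin n)) : permIsometry σ hσ (e α) = e (σ α) := by
  simp [permIsometry, e, OrthogonalFamily.linearIsometry_apply_single]

theorem diagOp_e (w : List (Fin n) → ℝ) (C : ℝ) (hC : ∀ α, |w α| ≤ C) (α : List (Fin n)) :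
    diagOp w C hC (e α) = (w α : ℂ) • e α := by
  ext β
  rw [lp.coeFn_smul, Pi.smul_apply, smul_eq_mul]
  change (w β : ℂ) * e α β = (w α : ℂ) * e α β
  by_cases h : β = α
  · rw [h]
  · simp [e, lp.single_apply, h]

variable (f : PosRegular n) (m : ℕ)

/-- The weighted left creation operators `W_i = S_i D_i`, that is
`W_i e_α = √(b_α / b_{g_i α}) e_{g_i α}`. -/
def W (i : Fin n) : Fock n →L[ℂ] Fock n :=
  permIsometry (fun α => i :: α) (List.cons_injective) *
    diagOp (fun α => √(f.b m α / f.b m (i :: α))) (1 / √(f.coeff [i]))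
      (fun α => sqrt_ratio_le (f.coeff_letter i) (f.b_nonneg m α) (f.b_cons_ge m i α))

/-- The weighted right creation operators `Λ_i = R_i G_i`, that is
`Λ_i e_α = √(b_α / b_{α g_i}) e_{α g_i}`. -/
def Lam (i : Fin n) : Fock n →L[ℂ] Fock n :=
  permIsometry (fun α => α ++ [i]) (List.append_left_injective [i]) *
    diagOp (fun α => √(f.b m α / f.b m (α ++ [i]))) (1 / √(f.coeff [i]))
      (fun α => sqrt_ratio_le (f.coeff_letter i) (f.b_nonneg m α) (f.b_snoc_ge m i α))

theorem W_e (i : Fin n) (α : List (Fin n)) :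
    W f m i (e α) = (√(f.b m α / f.b m (i :: α)) : ℂ) • e (i :: α) := by
  rw [W, mul_apply_eq_comp, diagOp_e, map_smul, permIsometry_e]

theorem Lam_e (i : Fin n) (α : List (Fin n)) :
    Lam f m i (e α) = (√(f.b m α / f.b m (α ++ [i])) : ℂ) • e (α ++ [i]) := by
  rw [Lam, mul_apply_eq_comp, diagOp_e, map_smul, permIsometry_e]

/-- The operator system `S`, the norm closed span of the operators `W_α W_β^*`. -/
def opSystem : Submodule ℂ (Fock n →L[ℂ] Fock n) :=
  (Submodule.span ℂ (Set.range fun p : List (Fin n) × List (Fin n) =>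
    mono (W f m) p.1 * star (mono (W f m) p.2))).topologicalClosure

/-- The domain algebra: the norm closure of the polynomials in `W_1, …, W_n` and the identity. -/
def domainAlgebra : Subalgebra ℂ (Fock n →L[ℂ] Fock n) :=
  (Algebra.adjoin ℂ (Set.range (W f m))).topologicalClosure

theorem mono_mem_opSystem (α β : List (Fin n)) :
    mono (W f m) α * star (mono (W f m) β) ∈ opSystem f m :=
  Submodule.le_topologicalClosure _ (Submodule.subset_span ⟨(α, β), rfl⟩)

theorem one_mem_opSystem : (1 : Fock n →L[ℂ] Fock n) ∈ opSystem f m := by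
  simpa [mono] using mono_mem_opSystem f m [] []

theorem domainAlgebra_le_opSystem :
    Subalgebra.toSubmodule (domainAlgebra f m) ≤ opSystem f m := by
  have h : Subalgebra.toSubmodule (Algebra.adjoin ℂ (Set.range (W f m))) ≤
      Submodule.span ℂ (Set.range fun p : List (Fin n) × List (Fin n) =>
        mono (W f m) p.1 * star (mono (W f m) p.2)) := by
    rw [Algebra.adjoin_eq_span]
    refine Submodule.span_mono ?_
    intro x hx
    obtain ⟨l, hl, rfl⟩ := Submonoid.exists_list_of_mem_closure hx
    have : ∃ α : List (Fin n), α.map (W f m) = l := by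
      clear hx
      induction l with
      | nil => exact ⟨[], rfl⟩
      | cons y l ih =>
        obtain ⟨α, hα⟩ := ih fun z hz => hl z (List.mem_cons_of_mem _ hz)
        obtain ⟨i, hi⟩ := hl y List.mem_cons_self
        exact ⟨i :: α, by simp [hα, hi]⟩
    obtain ⟨α, rfl⟩ := this
    exact ⟨(α, []), by simp [mono]⟩
  exact closure_mono h

end Creation

/-! ### Hilbert tensor products and sums in the weak operator topology -/

/-- The Hilbert space tensor product: the completion of the algebraic tensor product. -/
abbrev HTensor (E F : Type*) [NormedAddCommGroup E] [InnerProductSpace ℂ E]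
    [NormedAddCommGroup F] [InnerProductSpace ℂ F] : Type _ :=
  UniformSpace.Completion (E ⊗[ℂ] F)

/-- The operator `A ⊗ B` on the Hilbert tensor product. -/
def tensorOp {E F : Type*} [NormedAddCommGroup E] [InnerProductSpace ℂ E]
    [NormedAddCommGroup F] [InnerProductSpace ℂ F] (A : E →L[ℂ] E) (B : F →L[ℂ] F) :
    HTensor E F →L[ℂ] HTensor E F :=
  (TensorProduct.mapL A B).completion

/-- The operator `y ↦ x ⊗ y`. -/
def tensorVec {E : Type*} (F : Type*) [NormedAddCommGroup E] [InnerProductSpace ℂ E]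
    [NormedAddCommGroup F] [InnerProductSpace ℂ F] (x : E) : F →L[ℂ] HTensor E F :=
  UniformSpace.Completion.toComplL ∘L TensorProduct.mkL ℂ E F x

/-- Convergence of `∑ u_i` in the weak operator topology. -/
def WOTSummable {ι E F : Type*} [NormedAddCommGroup E] [InnerProductSpace ℂ E]
    [NormedAddCommGroup F] [InnerProductSpace ℂ F] (u : ι → E →L[ℂ] F) : Prop :=
  Summable fun i => ContinuousLinearMapWOT.ofCLM (u i)

/-- The sum of `∑ u_i` in the weak operator topology. -/
def wotSum {ι E F : Type*} [NormedAddCommGroup E] [InnerProductSpace ℂ E]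
    [NormedAddCommGroup F] [InnerProductSpace ℂ F] (u : ι → E →L[ℂ] F) : E →L[ℂ] F :=
  (∑' i, ContinuousLinearMapWOT.ofCLM (u i)).toCLM

/-! ### Noncommutative domains and Berezin transforms -/

section Domain

variable {n : ℕ} {H : Type*} [NormedAddCommGroup H] [InnerProductSpace ℂ H] [CompleteSpace H]

/-- `Φ_{f,T}(Y) = ∑_{|α| ≥ 1} a_α T_α Y T_α^*` (the term of the empty word vanishes). -/
def Phi (f : PosRegular n) (T : Fin n → H →L[ℂ] H) (Y : H →L[ℂ] H) : H →L[ℂ] H :=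
  wotSum fun α => (f.coeff α : ℂ) • (mono T α * Y * star (mono T α))

/-- `(id - Φ_{f,T})^k (I)`. -/
def defect (f : PosRegular n) (T : Fin n → H →L[ℂ] H) (k : ℕ) : H →L[ℂ] H :=
  (fun Y => Y - Phi f T Y)^[k] 1

/-- The noncommutative domain `D_f^m(H)`: the series defining `Φ_{f,T}(I)` converges and
`(id - Φ_{f,T})^k (I) ≥ 0` for `1 ≤ k ≤ m`. -/
def domain (f : PosRegular n) (m : ℕ) (H : Type*) [NormedAddCommGroup H] [InnerProductSpace ℂ H]
    [CompleteSpace H] : Set (Fin n → H →L[ℂ] H) :=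
  {T | WOTSummable (fun α => (f.coeff α : ℂ) • (mono T α * star (mono T α))) ∧
    ∀ k, 1 ≤ k → k ≤ m → 0 ≤ defect f T k}

/-- The tuple `rT = (rT_1, …, rT_n)`. -/
def scale (r : ℝ) (T : Fin n → H →L[ℂ] H) : Fin n → H →L[ℂ] H := fun i => (r : ℂ) • T i

/-- The radial property: `T ∈ D_f^m(H)` and `rT ∈ D_f^m(H)` for all `r` in some `(δ, 1)`. -/
def HasRadialProperty (f : PosRegular n) (m : ℕ) (T : Fin n → H →L[ℂ] H) : Prop :=
  T ∈ domain f m H ∧ ∃ δ : ℝ, 0 < δ ∧ δ < 1 ∧ ∀ r : ℝ, δ < r → r < 1 → scale r T ∈ domain f m H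

/-- `T` is pure: `Φ_{f,T}^k(I) → 0` in the strong operator topology. -/
def IsPure (f : PosRegular n) (T : Fin n → H →L[ℂ] H) : Prop :=
  ∀ x : H, Tendsto (fun k : ℕ => ((Phi f T)^[k] 1) x) atTop (𝓝 0)

/-- The joint spectral radius `r_f(T) = lim_k ‖Φ_{f,T}^k(I)‖^{1/2k}` exists and equals `s`. -/
def HasJointSpectralRadius (f : PosRegular n) (T : Fin n → H →L[ℂ] H) (s : ℝ) : Prop :=
  Tendsto (fun k : ℕ => ‖(Phi f T)^[k] 1‖ ^ (1 / (2 * (k : ℝ)))) atTop (𝓝 s)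

/-- The defect operator `Δ_{f,m,T} = [(id - Φ_{f,T})^m (I)]^{1/2}`. -/
def Delta (f : PosRegular n) (m : ℕ) (T : Fin n → H →L[ℂ] H) : H →L[ℂ] H :=
  CFC.sqrt (defect f T m)

/-- The terms `a_{α~} Λ_α ⊗ T_{α~}^*`, where `α~` is the reverse of `α`. -/
def resTerm (f : PosRegular n) (m : ℕ) (T : Fin n → H →L[ℂ] H) (α : List (Fin n)) :
    HTensor (Fock n) H →L[ℂ] HTensor (Fock n) H :=
  (f.coeff α.reverse : ℂ) • tensorOp (mono (Lam f m) α) (star (mono T α.reverse))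

/-- The terms `a_{α~} Λ_α^* ⊗ T_{α~}`. -/
def resTermStar (f : PosRegular n) (m : ℕ) (T : Fin n → H →L[ℂ] H) (α : List (Fin n)) :
    HTensor (Fock n) H →L[ℂ] HTensor (Fock n) H :=
  (f.coeff α.reverse : ℂ) • tensorOp (star (mono (Lam f m) α)) (mono T α.reverse)

/-- The data entering the definition of the Berezin transform at `T` make sense:
`T ∈ D_f^m(H)`, `r_f(T) < 1`, the two series over `|α| ≥ 1` converge and the operators
`I - ∑ a_{α~} Λ_α^* ⊗ T_{α~}` and `I - ∑ a_{α~} Λ_α ⊗ T_{α~}^*` are invertible. -/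
structure BerezinDefined (f : PosRegular n) (m : ℕ) (T : Fin n → H →L[ℂ] H) : Prop where
  mem_domain : T ∈ domain f m H
  radius_lt_one : ∃ s < 1, HasJointSpectralRadius f T s
  summable : WOTSummable (resTerm f m T)
  summable_star : WOTSummable (resTermStar f m T)
  isUnit : IsUnit (1 - wotSum (resTerm f m T))
  isUnit_star : IsUnit (1 - wotSum (resTermStar f m T))

/-- The noncommutative Berezin transform `B_T`, given by
`⟨B_T[g] x, y⟩ = ⟨(I - ∑ a_{α~} Λ_α^* ⊗ T_{α~})^{-m} (g ⊗ Δ²)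
  (I - ∑ a_{α~} Λ_α ⊗ T_{α~}^*)^{-m} (1 ⊗ x), 1 ⊗ y⟩`. -/
def berezin (f : PosRegular n) (m : ℕ) (T : Fin n → H →L[ℂ] H) (g : Fock n →L[ℂ] Fock n) :
    H →L[ℂ] H :=
  (tensorVec H (e [] : Fock n)).adjoint ∘L
    (Ring.inverse (1 - wotSum (resTermStar f m T)) ^ m * tensorOp g (Delta f m T ^ 2) *
      Ring.inverse (1 - wotSum (resTerm f m T)) ^ m) ∘L tensorVec H (e [] : Fock n)

/-- The terms `h ↦ √b_α e_α ⊗ Δ T_α^* h` of the Berezin kernel. -/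
def kernelTerm (f : PosRegular n) (m : ℕ) (T : Fin n → H →L[ℂ] H) (α : List (Fin n)) :
    H →L[ℂ] HTensor (Fock n) H :=
  (√(f.b m α) : ℂ) • (tensorVec H (e α) ∘L Delta f m T ∘L star (mono T α))

/-- The noncommutative Berezin kernel `K_{f,T}^{(m)} h = ∑_α √b_α e_α ⊗ Δ T_α^* h`. -/
def kernel (f : PosRegular n) (m : ℕ) (T : Fin n → H →L[ℂ] H) : H →L[ℂ] HTensor (Fock n) H :=
  wotSum (kernelTerm f m T)

/-- The extended noncommutative Berezin transform `K^* (g ⊗ I) K`. -/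
def extBerezin (f : PosRegular n) (m : ℕ) (T : Fin n → H →L[ℂ] H) (g : Fock n →L[ℂ] Fock n) :
    H →L[ℂ] H :=
  (kernel f m T).adjoint ∘L tensorOp g 1 ∘L kernel f m T

end Domain

/-! ### Completely contractive maps -/

/-- The operator on the Hilbert space direct sum `E^{(k)}` given by a `k × k` operator matrix. -/
def opMatrix {E : Type*} [NormedAddCommGroup E] [InnerProductSpace ℂ E] {k : ℕ}
    (x : Matrix (Fin k) (Fin k) (E →L[ℂ] E)) :
    PiLp 2 (fun _ : Fin k => E) →L[ℂ] PiLp 2 (fun _ : Fin k => E) :=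
  (PiLp.continuousLinearEquiv 2 ℂ (fun _ : Fin k => E)).symm.toContinuousLinearMap ∘L
    ContinuousLinearMap.pi fun i => ∑ j, x i j ∘L PiLp.proj 2 (fun _ : Fin k => E) j

/-- A linear map `u` from a space `X` of operators on `E` to the operators on `F` is completely
contractive: `‖[u(x_{ij})]‖ ≤ ‖[x_{ij}]‖` for all square matrices over `X`. -/
def CompletelyContractive {E F : Type*} [NormedAddCommGroup E] [InnerProductSpace ℂ E]
    [NormedAddCommGroup F] [InnerProductSpace ℂ F] {X : Submodule ℂ (E →L[ℂ] E)}
    (u : X →ₗ[ℂ] (F →L[ℂ] F)) : Prop :=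
  ∀ (k : ℕ) (x : Matrix (Fin k) (Fin k) X),
    ‖opMatrix fun i j => u (x i j)‖ ≤ ‖opMatrix fun i j => (x i j : E →L[ℂ] E)‖

end NCDomain

end

/-! The condition `k = 1` in the definition of the domain says Φ_{f,T}(I) ≤ I. Since f has no
constant term, each word that contributes to Φ_{f,rT} carries a factor r^(2|α|) ≤ r², so X = rT
satisfies Φ_{f,X}^j(I) ≤ r^(2j) I, which tends to zero for r < 1. By the radial property the defects
D_k = (id - Φ_{f,X})^k(I) are nonnegative for k ≤ m, and D_k = D_{k+1} + Φ_{f,X}(D_k). Summation by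
parts (`tsum_multichoose_mul`) turns this into the resolution of the identity ∑ b_α X_α Δ² X_α^* = I
(`tsum_b_mul_norm_Delta_sq`), which says that the Berezin kernel K of X is an isometry. The weights
of W_i are chosen so that (W_i^* ⊗ I) K = K X_i^*. Hence g ↦ K^* (g ⊗ I) K is unital, completely
contractive (`norm_opMatrix_compression_le`), sends W_α W_β^* to r^(|α|+|β|) T_α T_β^*, and is
multiplicative when the left factor lies in the domain algebra.

This compression is the Berezin transform of X (`RowBound.berezin_eq_extBerezin`). Let R = ∑ a_{α~}
Λ_α ⊗ X_{α~}^*. The b_α are the coefficients of (1 - f)^(-m), and in coordinates R is a weighted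
convolution with the a_α; so (1 - R)^(-m) (1 ⊗ x) = ∑ √b_α e_α ⊗ X_α^* x
(`RowBound.inverse_pow_tensorVec`). The inverse exists because ‖R‖ ≤ r
(`RowBound.exists_resolvent`), by Cauchy–Schwarz, the row bound for X, and the inequality b * a ≤ b
for the convolution, which comes from (1 - f)^(-m) = (1 - f)^(-(m-1)) + (1 - f)^(-m) f.

As r → 1 these contractions converge on the generators W_α W_β^*, hence on their closed span
(`exists_tendsto_of_mem_closure_span`), and the algebraic and norm properties pass to the limit. For
pure T the kernel of T itself is an isometry, and its compression agrees with the limit on the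
generators. -/

set_option linter.unusedSectionVars false

noncomputable section

namespace NCDomain

open scoped ENNReal

/-! ### Coefficients of the powers of a free power series -/

section Coefficients

variable {n : ℕ} (f : PosRegular n)

/-- The coefficients of the formal power series `f ^ j`. -/
def PosRegular.convPow : ℕ → List (Fin n) → ℝ
  | 0, δ => if δ = [] then 1 else 0
  | j + 1, δ => ∑ i ∈ Finset.range (δ.length + 1),
      PosRegular.convPow j (δ.take i) * f.coeff (δ.drop i)

theorem PosRegular.convPow_nonneg (j : ℕ) (δ : List (Fin n)) : 0 ≤ f.convPow j δ := by
  induction j generalizing δ with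
  | zero => unfold PosRegular.convPow; split_ifs <;> norm_num
  | succ j ih =>
    exact Finset.sum_nonneg fun i _ => mul_nonneg (ih _) (f.coeff_nonneg _)

/-- Since f has no constant term, `f ^ j` starts in degree `j`. Thus at a fixed word all series in
powers of f are finite sums. -/
theorem PosRegular.convPow_eq_zero (j : ℕ) (δ : List (Fin n)) (h : δ.length < j) :
    f.convPow j δ = 0 := by
  induction j generalizing δ with
  | zero => omega
  | succ j ih =>
    refine Finset.sum_eq_zero fun i hi => ?_
    rcases lt_or_ge i δ.length with h' | h'
    · rw [ih _ (by simp; omega), zero_mul]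
    · rw [List.drop_eq_nil_of_le h', f.coeff_nil, mul_zero]

theorem splitAux_append (β : List (Fin n)) : ∀ (ns : List ℕ) (α : List (Fin n)),
    ns.sum = α.length → (α ++ β).splitWrtCompositionAux (ns ++ [β.length]) =
      α.splitWrtCompositionAux ns ++ [β]
  | [], α, h => by
    have : α = [] := List.length_eq_zero_iff.1 (by simpa using h.symm)
    subst this
    simp [List.splitWrtCompositionAux]
  | k :: ns, α, h => by
    have hk : k ≤ α.length := by simp at h; omega
    have h2 : ns.sum = (α.drop k).length := by simp at h ⊢; omega
    rw [List.cons_append, List.splitWrtCompositionAux_cons, List.splitWrtCompositionAux_cons,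
      List.take_append_of_le_length hk, List.drop_append_of_le_length hk,
      splitAux_append β ns _ h2, List.cons_append]

/-- The composition of `N` with last block `N - i` that extends a composition of `i < N`. -/
def snocComposition {N : ℕ} (p : Σ i : Fin N, Composition (i : ℕ)) : Composition N :=
  ⟨p.2.blocks ++ [N - p.1], by
    intro k hk
    rcases List.mem_append.1 hk with hk | hk
    · exact p.2.blocks_pos hk
    · have := p.1.2
      rw [List.mem_singleton.1 hk]; omega, by
    have := p.1.2
    simp [p.2.blocks_sum]⟩

/-- The cut point is the sum of all blocks but the last. For `N = 0` the left side is empty although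
the empty composition exists, whence `0 < N`. -/
theorem snocComposition_bijective {N : ℕ} (hN : 0 < N) :
    Function.Bijective (snocComposition (N := N)) := by
  constructor
  · rintro ⟨⟨i, hi⟩, c⟩ ⟨⟨j, hj⟩, d⟩ h
    have h1 := congrArg Composition.blocks h
    obtain ⟨h2, h3⟩ := List.append_inj' h1 rfl
    have h4 : N - i = N - j := by simpa using h3
    have h5 : i = j := by omega
    subst h5
    have : c = d := Composition.ext h2
    rw [this]
  · intro c
    have hne : c.blocks ≠ [] := by
      intro h0
      have := c.blocks_sum
      rw [h0] at this
      simp at this; omega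
    have hs : c.blocks.dropLast.sum + c.blocks.getLast hne = N := by
      conv_rhs => rw [← c.blocks_sum, ← List.dropLast_append_getLast hne]
      simp
    have hp : 0 < c.blocks.getLast hne := c.blocks_pos (List.getLast_mem hne)
    refine ⟨⟨⟨c.blocks.dropLast.sum, by omega⟩,
      ⟨c.blocks.dropLast, fun hk => c.blocks_pos (List.dropLast_subset _ hk), rfl⟩⟩, ?_⟩
    refine Composition.ext ?_
    simp only [snocComposition]
    rw [show N - c.blocks.dropLast.sum = c.blocks.getLast hne by omega]
    exact List.dropLast_append_getLast hne

/-- Factorizations of `δ` into `j` nonempty words add up to the coefficient of `f ^ j`. The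
induction removes the last factor, which shifts the weight to `w (j + 1)`; this is why `w` is
arbitrary. -/
theorem PosRegular.sum_composition (N : ℕ) (w : ℕ → ℝ) (δ : List (Fin n)) (hδ : δ.length = N) :
    ∑ c : Composition N, ((δ.splitWrtComposition c).map f.coeff).prod * w c.length =
      ∑ j ∈ Finset.range (N + 1), w j * f.convPow j δ := by
  induction N using Nat.strong_induction_on generalizing w δ with
  | _ N ih =>
  rcases Nat.eq_zero_or_pos N with rfl | hN
  · have : δ = [] := List.length_eq_zero_iff.1 hδ
    subst this
    have hbl : ∀ c : Composition 0, c.blocks = [] := by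
      intro c
      by_contra h0
      have h1 := c.blocks_pos (List.getLast_mem h0)
      have h2 := List.le_sum_of_mem (List.getLast_mem h0)
      rw [c.blocks_sum] at h2
      omega
    have : Subsingleton (Composition 0) :=
      ⟨fun c d => Composition.ext ((hbl c).trans (hbl d).symm)⟩
    rw [Fintype.sum_subsingleton _ (default : Composition 0)]
    simp [List.splitWrtComposition, Composition.length, PosRegular.convPow, hbl,
      List.splitWrtCompositionAux]
  · rw [← (Equiv.ofBijective _ (snocComposition_bijective hN)).sum_comp, Fintype.sum_sigma]
    have step : ∀ i : Fin N, ∑ c : Composition (i : ℕ),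
        ((δ.splitWrtComposition (snocComposition ⟨i, c⟩)).map f.coeff).prod *
          w (snocComposition ⟨i, c⟩).length =
        ∑ j ∈ Finset.range N, w (j + 1) * (f.convPow j (δ.take i) * f.coeff (δ.drop i)) := by
      intro i
      have hi := i.2
      have hlen : (δ.take i).length = i := by simp; omega
      have hsub : Finset.range (i + 1 : ℕ) ⊆ Finset.range N := by
        intro x hx; simp at hx ⊢; omega
      -- Words of length `i` have no coefficient in `f ^ j` for `j > i`, so the range of `j` can be
      -- made independent of `i` and the two sums exchanged.
      have hzero : ∀ j ∈ Finset.range N, j ∉ Finset.range (i + 1 : ℕ) →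
          w (j + 1) * f.convPow j (δ.take i) = 0 := by
        intro j _ hj
        rw [f.convPow_eq_zero j _ (by simp at hj ⊢; omega), mul_zero]
      calc _ = (∑ c : Composition (i : ℕ),
            (((δ.take i).splitWrtComposition c).map f.coeff).prod * w (c.length + 1)) *
              f.coeff (δ.drop i) := by
            rw [Finset.sum_mul]
            refine Finset.sum_congr rfl fun c _ => ?_
            have h1 : δ.splitWrtComposition (snocComposition ⟨i, c⟩) =
                (δ.take i).splitWrtComposition c ++ [δ.drop i] := by
              have := splitAux_append (δ.drop i) c.blocks (δ.take i) (by rw [c.blocks_sum, hlen])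
              rw [List.take_append_drop, List.length_drop, hδ] at this
              exact this
            have h2 : (snocComposition ⟨i, c⟩).length = c.length + 1 := by
              simp [snocComposition, Composition.length]
            rw [h1, h2, List.map_append, List.prod_append, List.map_singleton,
              List.prod_singleton]
            ring
        _ = _ := by
            rw [ih i hi (fun j => w (j + 1)) _ hlen, Finset.sum_subset hsub hzero, Finset.sum_mul]
            exact Finset.sum_congr rfl fun j _ => by ring
    change ∑ i : Fin N, ∑ c : Composition (i : ℕ),
        ((δ.splitWrtComposition (snocComposition ⟨i, c⟩)).map f.coeff).prod *
          w (snocComposition ⟨i, c⟩).length = _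
    rw [Finset.sum_congr rfl fun i _ => step i, Finset.sum_comm, Finset.sum_range_succ']
    have h0 : f.convPow 0 δ = 0 := by
      have : δ ≠ [] := by rintro rfl; simp at hδ; omega
      simp [PosRegular.convPow, this]
    rw [h0, mul_zero, add_zero]
    refine Finset.sum_congr rfl fun j _ => ?_
    rw [← Finset.mul_sum]
    congr 1
    -- The cut at the end of `δ` is paired with `f.coeff [] = 0`; only the cuts `i < N` remain.
    rw [PosRegular.convPow, hδ, Finset.sum_range_succ, List.drop_eq_nil_of_le hδ.le, f.coeff_nil,
      mul_zero, add_zero, Finset.sum_range]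

/-- The coefficients of the formal power series `(1 - f) ^ (-k)`. -/
def PosRegular.wt (k : ℕ) (δ : List (Fin n)) : ℝ :=
  ∑ j ∈ Finset.range (δ.length + 1), (k.multichoose j : ℝ) * f.convPow j δ

theorem PosRegular.b_eq_wt {m : ℕ} (hm : 1 ≤ m) (δ : List (Fin n)) : f.b m δ = f.wt m δ := by
  refine (f.sum_composition δ.length (fun j => ((j + m - 1).choose (m - 1) : ℝ)) δ rfl).trans ?_
  refine Finset.sum_congr rfl fun j _ => ?_
  congr 2
  rw [Nat.multichoose_eq, Nat.choose_symm_of_eq_add (b := j) (by omega), add_comm j m]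

theorem PosRegular.wt_nonneg (k : ℕ) (δ : List (Fin n)) : 0 ≤ f.wt k δ :=
  Finset.sum_nonneg fun _ _ => mul_nonneg (Nat.cast_nonneg _) (f.convPow_nonneg _ _)

theorem PosRegular.wt_eq_sum_range (k : ℕ) (δ : List (Fin n)) {N : ℕ} (hN : δ.length < N) :
    f.wt k δ = ∑ j ∈ Finset.range N, (k.multichoose j : ℝ) * f.convPow j δ := by
  refine Finset.sum_subset (fun x hx => by simp at hx ⊢; omega) fun j _ hj => ?_
  rw [f.convPow_eq_zero j _ (by simpa using hj), mul_zero]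

theorem PosRegular.wt_zero (δ : List (Fin n)) : f.wt 0 δ = if δ = [] then 1 else 0 := by
  rw [PosRegular.wt, Finset.sum_range_succ']
  simp [PosRegular.convPow]

/-- Coefficients of (1 - f)^(-(k+1)) = (1 - f)^(-k) + (1 - f)^(-(k+1)) f, by Pascal's rule for
`multichoose`. The recursion yields both the row bound for the Λ_α and the powers of the resolvent.
-/
theorem PosRegular.wt_succ (k : ℕ) (δ : List (Fin n)) :
    f.wt (k + 1) δ = f.wt k δ + ∑ i ∈ Finset.range (δ.length + 1),
      f.wt (k + 1) (δ.take i) * f.coeff (δ.drop i) := by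
  have h : ∑ i ∈ Finset.range (δ.length + 1), f.wt (k + 1) (δ.take i) * f.coeff (δ.drop i) =
      ∑ j ∈ Finset.range δ.length, ((k + 1).multichoose j : ℝ) * f.convPow (j + 1) δ := by
    calc _ = ∑ i ∈ Finset.range (δ.length + 1), ∑ j ∈ Finset.range (δ.length + 1),
          ((k + 1).multichoose j : ℝ) * (f.convPow j (δ.take i) * f.coeff (δ.drop i)) := by
          refine Finset.sum_congr rfl fun i _ => ?_
          rw [f.wt_eq_sum_range (k + 1) (δ.take i) (N := δ.length + 1) (by simp),
            Finset.sum_mul]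
          exact Finset.sum_congr rfl fun j _ => by ring
      _ = ∑ j ∈ Finset.range (δ.length + 1),
          ((k + 1).multichoose j : ℝ) * f.convPow (j + 1) δ := by
          rw [Finset.sum_comm]
          refine Finset.sum_congr rfl fun j _ => ?_
          rw [← Finset.mul_sum]
          rfl
      _ = _ := by
          rw [Finset.sum_range_succ, f.convPow_eq_zero (δ.length + 1) δ (by omega), mul_zero,
            add_zero]
  rw [h, PosRegular.wt, PosRegular.wt, Finset.sum_range_succ', Finset.sum_range_succ' _ δ.length,
    Nat.multichoose_zero_right, Nat.multichoose_zero_right, add_right_comm,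
    ← Finset.sum_add_distrib]
  congr 1
  refine Finset.sum_congr rfl fun j _ => ?_
  rw [Nat.multichoose_succ_succ]
  push_cast
  ring

theorem PosRegular.wt_le_succ (k : ℕ) (δ : List (Fin n)) : f.wt k δ ≤ f.wt (k + 1) δ := by
  rw [f.wt_succ]
  exact le_add_of_nonneg_right
    (Finset.sum_nonneg fun _ _ => mul_nonneg (f.wt_nonneg _ _) (f.coeff_nonneg _))

theorem PosRegular.wt_mono {k l : ℕ} (h : k ≤ l) (δ : List (Fin n)) : f.wt k δ ≤ f.wt l δ :=
  monotone_nat_of_le_succ (fun k => f.wt_le_succ k δ) h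

theorem PosRegular.b_nil (m : ℕ) : f.b m [] = 1 := by
  refine (f.sum_composition 0 (fun j => ((j + m - 1).choose (m - 1) : ℝ)) [] rfl).trans ?_
  simp [PosRegular.convPow]

theorem PosRegular.b_pos (m : ℕ) (δ : List (Fin n)) : 0 < f.b m δ := by
  induction δ with
  | nil => rw [f.b_nil]; exact one_pos
  | cons i δ ih => exact (mul_pos (f.coeff_letter i) ih).trans_le (f.b_cons_ge m i δ)

/-- The term dropped from the recursion is a coefficient of (1 - f)^(-(m-1)), hence nonnegative. -/
theorem PosRegular.sum_b_mul_coeff_le {m : ℕ} (hm : 1 ≤ m) (δ : List (Fin n)) :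
    ∑ i ∈ Finset.range (δ.length + 1), f.b m (δ.take i) * f.coeff (δ.drop i) ≤ f.b m δ := by
  obtain ⟨k, rfl⟩ : ∃ k, m = k + 1 := ⟨m - 1, by omega⟩
  simp only [f.b_eq_wt hm]
  rw [f.wt_succ k δ]
  exact le_add_of_nonneg_left (f.wt_nonneg _ _)

end Coefficients

/-! ### Nonnegative sums over words -/

section Sums

variable {n : ℕ}

/-- Pairs of words correspond to words with a marked cut. -/
def cutEquiv : (Σ δ : List (Fin n), Fin (δ.length + 1)) ≃ List (Fin n) × List (Fin n) where
  toFun p := (p.1.take p.2, p.1.drop p.2)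
  invFun q := ⟨q.1 ++ q.2, ⟨q.1.length, by simp⟩⟩
  left_inv p := by
    obtain ⟨δ, i, hi⟩ := p
    have h1 : δ.take i ++ δ.drop i = δ := List.take_append_drop i δ
    refine Sigma.ext h1 ?_
    rw [Fin.heq_ext_iff (congrArg (fun l => l.length + 1) h1)]
    simp; omega
  right_inv q := by simp

/-- Regrouping by the concatenation `δ = γβ`. With values in `ℝ≥0∞` no summability has to be
checked. -/
theorem tsum_words_prod (F : List (Fin n) → List (Fin n) → ℝ≥0∞) :
    ∑' γ, ∑' β, F γ β =
      ∑' δ : List (Fin n), ∑ i ∈ Finset.range (δ.length + 1), F (δ.take i) (δ.drop i) := by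
  rw [← ENNReal.tsum_prod, ← cutEquiv.tsum_eq, ENNReal.tsum_sigma']
  refine tsum_congr fun δ => ?_
  rw [tsum_fintype, Finset.sum_range (fun i => F (δ.take i) (δ.drop i))]
  rfl

theorem mono_append {A : Type*} [Monoid A] (X : Fin n → A) (α β : List (Fin n)) :
    mono X (α ++ β) = mono X α * mono X β := by
  simp [mono]

theorem mono_cons {A : Type*} [Monoid A] (X : Fin n → A) (i : Fin n) (α : List (Fin n)) :
    mono X (i :: α) = X i * mono X α := by
  simp [mono]

theorem mono_nil {A : Type*} [Monoid A] (X : Fin n → A) : mono X [] = 1 := rfl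

variable {H : Type*} [NormedAddCommGroup H] [InnerProductSpace ℂ H] [CompleteSpace H]
  (f : PosRegular n) (T : Fin n → H →L[ℂ] H)

/-- The action of `Φ_{f,T}` on nonnegative forms: `q ↦ ∑ a_α q(T_α^* h)`. -/
def formMap (q : H → ℝ≥0∞) (h : H) : ℝ≥0∞ :=
  ∑' α, ENNReal.ofReal (f.coeff α) * q (star (mono T α) h)

/-- Because T_β^* T_γ^* = T_{γβ}^*, composing two such sums convolves their coefficients. -/
theorem formMap_iterate (j : ℕ) (q : H → ℝ≥0∞) (h : H) :
    (formMap f T)^[j] q h = ∑' α, ENNReal.ofReal (f.convPow j α) * q (star (mono T α) h) := by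
  induction j generalizing q with
  | zero =>
    rw [tsum_eq_single []]
    · simp [PosRegular.convPow, mono_nil]
    · intro α hα; simp [PosRegular.convPow, hα]
  | succ j ih =>
    rw [Function.iterate_succ_apply, ih]
    simp only [formMap, ← ENNReal.tsum_mul_left]
    rw [tsum_words_prod (fun γ β => ENNReal.ofReal (f.convPow j γ) *
      (ENNReal.ofReal (f.coeff β) * q (star (mono T β) (star (mono T γ) h))))]
    refine tsum_congr fun δ => ?_
    rw [PosRegular.convPow, ENNReal.ofReal_sum_of_nonneg
      (fun i _ => mul_nonneg (f.convPow_nonneg _ _) (f.coeff_nonneg _)), Finset.sum_mul]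
    refine Finset.sum_congr rfl fun i _ => ?_
    rw [ENNReal.ofReal_mul (f.convPow_nonneg _ _), mul_assoc]
    congr 3
    conv_rhs => rw [← List.take_append_drop i δ, mono_append, star_mul]
    rfl

/-- Both sides expand (id - Φ)^(-k) applied to the form, once by words and once by powers of Φ;
Tonelli exchanges the sums. -/
theorem tsum_wt_mul_form (k : ℕ) (q : H → ℝ≥0∞) (h : H) :
    ∑' α, ENNReal.ofReal (f.wt k α) * q (star (mono T α) h) =
      ∑' j, (k.multichoose j : ℝ≥0∞) * (formMap f T)^[j] q h := by
  simp only [formMap_iterate, ← ENNReal.tsum_mul_left]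
  rw [ENNReal.tsum_comm]
  refine tsum_congr fun α => ?_
  simp only [← mul_assoc]
  rw [ENNReal.tsum_mul_right]
  congr 1
  rw [tsum_eq_sum (s := Finset.range (α.length + 1)), PosRegular.wt,
    ENNReal.ofReal_sum_of_nonneg
      (fun i _ => mul_nonneg (Nat.cast_nonneg _) (f.convPow_nonneg _ _))]
  · refine Finset.sum_congr rfl fun j _ => ?_
    rw [ENNReal.ofReal_mul (Nat.cast_nonneg _), ENNReal.ofReal_natCast]
  · intro j hj
    rw [f.convPow_eq_zero j α (by simpa using hj)]
    simp

theorem formMap_mono {p q : H → ℝ≥0∞} (h : p ≤ q) : formMap f T p ≤ formMap f T q :=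
  fun _ => ENNReal.tsum_le_tsum fun _ => mul_le_mul_right (h _) _

theorem formMap_add (p q : H → ℝ≥0∞) :
    formMap f T (p + q) = formMap f T p + formMap f T q := by
  ext h
  simp only [formMap, Pi.add_apply, mul_add, ENNReal.tsum_add]

theorem formMap_smul (c : ℝ≥0∞) (q : H → ℝ≥0∞) :
    formMap f T (c • q) = c • formMap f T q := by
  ext h
  simp only [formMap, Pi.smul_apply, smul_eq_mul, ← ENNReal.tsum_mul_left]
  exact tsum_congr fun _ => by ring

/-- Iterated summation by parts: if `d (k + 1)` is the negative difference sequence of `d k` and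
`d 0` tends to zero, then `d 0 0` is recovered from `d k`. -/
theorem tsum_multichoose_mul {m : ℕ} (d : ℕ → ℕ → ℝ≥0∞)
    (hd : ∀ k < m, ∀ j, d (k + 1) j + d k (j + 1) = d k j)
    (hlim : Tendsto (d 0) atTop (𝓝 0)) {k : ℕ} (hk : k ≤ m) :
    ∑' j, (k.multichoose j : ℝ≥0∞) * d k j = d 0 0 := by
  have hlim' : ∀ k ≤ m, Tendsto (d k) atTop (𝓝 0) := by
    intro k hk
    induction k with
    | zero => exact hlim
    | succ k ih =>
      refine tendsto_of_tendsto_of_tendsto_of_le_of_le tendsto_const_nhds (ih (by omega))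
        (fun _ => zero_le) fun j => ?_
      rw [← hd k (by omega) j]
      exact le_self_add
  -- Telescoping; the remainder `d k (N + j)` tends to zero.
  have htail : ∀ k < m, ∀ j, ∑' i, d (k + 1) (i + j) = d k j := by
    intro k hk j
    have hpart : ∀ N, ∑ i ∈ Finset.range N, d (k + 1) (i + j) + d k (N + j) = d k j := by
      intro N
      induction N with
      | zero => simp
      | succ N ih =>
        rw [Finset.sum_range_succ, add_assoc, show N + 1 + j = N + j + 1 by ring,
          hd k hk (N + j), ih]
    have h1 : Tendsto (fun N => ∑ i ∈ Finset.range N, d (k + 1) (i + j) + d k (N + j)) atTop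
        (𝓝 (∑' i, d (k + 1) (i + j) + 0)) :=
      (ENNReal.tendsto_nat_tsum _).add ((tendsto_add_atTop_iff_nat j).2 (hlim' k hk.le))
    simp only [hpart, add_zero] at h1
    exact tendsto_nhds_unique h1 tendsto_const_nhds
  induction k with
  | zero =>
    rw [tsum_eq_single 0]
    · simp
    · intro j hj
      obtain ⟨i, rfl⟩ := Nat.exists_eq_succ_of_ne_zero hj
      simp
  | succ k ih =>
    rw [← ih (by omega)]
    -- Hockey-stick identity. Inserting it and exchanging the sums leaves tails of `d (k + 1)`,
    -- which `htail` collapses to `d k`.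
    have hmc : ∀ j, (k + 1).multichoose j = ∑ i ∈ Finset.range (j + 1), k.multichoose i := by
      intro j
      induction j with
      | zero => simp
      | succ j ihj => rw [Finset.sum_range_succ, ← ihj, Nat.multichoose_succ_succ, add_comm]
    have hl : ∀ j, ((k + 1).multichoose j : ℝ≥0∞) * d (k + 1) j =
        ∑' i, if i ≤ j then (k.multichoose i : ℝ≥0∞) * d (k + 1) j else 0 := by
      intro j
      rw [tsum_eq_sum (s := Finset.range (j + 1)), hmc, Nat.cast_sum, Finset.sum_mul]
      · refine Finset.sum_congr rfl fun i hi => ?_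
        rw [if_pos (by simpa [Nat.lt_succ_iff] using hi)]
      · intro i hi
        rw [if_neg (by simpa [Nat.lt_succ_iff] using hi)]
    simp only [hl]
    rw [ENNReal.tsum_comm]
    refine tsum_congr fun i => ?_
    rw [← htail k (by omega) i, ← ENNReal.tsum_mul_left,
      ← Summable.sum_add_tsum_nat_add' (k := i) (f := fun j =>
        if i ≤ j then (k.multichoose i : ℝ≥0∞) * d (k + 1) j else 0) ENNReal.summable]
    rw [Finset.sum_eq_zero, zero_add]
    · exact tsum_congr fun j => by rw [if_pos (Nat.le_add_left i j)]
    · intro j hj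
      rw [if_neg (by simpa using hj)]

end Sums

/-! ### Hilbert tensor products -/

section Tensor

variable {E E' E'' F F' F'' : Type*}
  [NormedAddCommGroup E] [InnerProductSpace ℂ E] [NormedAddCommGroup E'] [InnerProductSpace ℂ E']
  [NormedAddCommGroup E''] [InnerProductSpace ℂ E'']
  [NormedAddCommGroup F] [InnerProductSpace ℂ F] [NormedAddCommGroup F'] [InnerProductSpace ℂ F']
  [NormedAddCommGroup F''] [InnerProductSpace ℂ F'']

/-- The operator `A ⊗ B` between Hilbert tensor products. -/
def tensorMap (A : E →L[ℂ] E') (B : F →L[ℂ] F') : HTensor E F →L[ℂ] HTensor E' F' :=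
  (TensorProduct.mapL A B).completion

theorem tensorVec_apply (x : E) (y : F) :
    tensorVec F x y = ((x ⊗ₜ[ℂ] y : E ⊗[ℂ] F) : HTensor E F) := rfl

theorem tensorMap_tensorVec (A : E →L[ℂ] E') (B : F →L[ℂ] F') (x : E) (y : F) :
    tensorMap A B (tensorVec F x y) = tensorVec F' (A x) (B y) := by
  rw [tensorVec_apply, tensorMap, ContinuousLinearMap.completion_apply_coe]
  rfl

theorem inner_tensorVec (x x' : E) (y y' : F) :
    inner ℂ (tensorVec F x y) (tensorVec F x' y') = inner ℂ x x' * inner ℂ y y' := by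
  rw [tensorVec_apply, tensorVec_apply, UniformSpace.Completion.inner_coe,
    TensorProduct.inner_tmul]

theorem HTensor.clm_ext {G : Type*} [NormedAddCommGroup G] [NormedSpace ℂ G]
    {A B : HTensor E F →L[ℂ] G} (h : ∀ x y, A (tensorVec F x y) = B (tensorVec F x y)) :
    A = B := by
  ext v
  induction v using UniformSpace.Completion.induction_on with
  | hp => exact isClosed_eq A.continuous B.continuous
  | ih v =>
    induction v using TensorProduct.induction_on with
    | zero => rw [UniformSpace.Completion.coe_zero, map_zero, map_zero]
    | tmul x y => exact h x y
    | add v w hv hw => rw [UniformSpace.Completion.coe_add, map_add, map_add, hv, hw]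

theorem HTensor.ext_inner {v w : HTensor E F}
    (h : ∀ x y, inner ℂ v (tensorVec F x y) = inner ℂ w (tensorVec F x y)) : v = w := by
  have : innerSL ℂ v = innerSL ℂ w := HTensor.clm_ext fun x y => by simpa using h x y
  refine ext_inner_right ℂ fun u => ?_
  simpa using congrArg (fun A : HTensor E F →L[ℂ] ℂ => A u) this

theorem tensorMap_comp (A : E' →L[ℂ] E'') (A' : E →L[ℂ] E') (B : F' →L[ℂ] F'')
    (B' : F →L[ℂ] F') : tensorMap (A ∘L A') (B ∘L B') = tensorMap A B ∘L tensorMap A' B' :=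
  HTensor.clm_ext fun x y => by simp [tensorMap_tensorVec]

theorem tensorMap_one : tensorMap (1 : E →L[ℂ] E) (1 : F →L[ℂ] F) = 1 :=
  HTensor.clm_ext fun x y => by simp [tensorMap_tensorVec]

theorem tensorVec_add (x x' : E) : tensorVec F (x + x') = tensorVec F x + tensorVec F x' := by
  ext y
  simp [tensorVec]

theorem tensorVec_smul (c : ℂ) (x : E) : tensorVec F (c • x) = c • tensorVec F x := by
  ext y
  simp [tensorVec]

theorem tensorVec_zero : tensorVec F (0 : E) = 0 := by
  ext y
  simp [tensorVec]

theorem tensorMap_add_left (A A' : E →L[ℂ] E') (B : F →L[ℂ] F') :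
    tensorMap (A + A') B = tensorMap A B + tensorMap A' B :=
  HTensor.clm_ext fun x y => by simp [tensorMap_tensorVec, tensorVec_add]

theorem tensorMap_smul_left (c : ℂ) (A : E →L[ℂ] E') (B : F →L[ℂ] F') :
    tensorMap (c • A) B = c • tensorMap A B :=
  HTensor.clm_ext fun x y => by simp [tensorMap_tensorVec, tensorVec_smul]

theorem norm_tensorMap_le (A : E →L[ℂ] E') (B : F →L[ℂ] F') :
    ‖tensorMap A B‖ ≤ ‖A‖ * ‖B‖ := by
  refine ContinuousLinearMap.opNorm_le_bound _ (by positivity) fun v => ?_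
  induction v using UniformSpace.Completion.induction_on with
  | hp => exact isClosed_le (by fun_prop) (by fun_prop)
  | ih v =>
    rw [tensorMap, ContinuousLinearMap.completion_apply_coe, UniformSpace.Completion.norm_coe,
      UniformSpace.Completion.norm_coe]
    exact (ContinuousLinearMap.le_opNorm _ _).trans
      (mul_le_mul_of_nonneg_right (TensorProduct.norm_mapL_le A B) (norm_nonneg _))

theorem adjoint_tensorMap [CompleteSpace E] [CompleteSpace E'] [CompleteSpace F]
    [CompleteSpace F'] (A : E →L[ℂ] E') (B : F →L[ℂ] F') :
    (tensorMap A B).adjoint = tensorMap A.adjoint B.adjoint := by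
  refine HTensor.clm_ext fun x y => HTensor.ext_inner fun x' y' => ?_
  rw [ContinuousLinearMap.adjoint_inner_left, tensorMap_tensorVec, tensorMap_tensorVec,
    inner_tensorVec, inner_tensorVec, ContinuousLinearMap.adjoint_inner_left,
    ContinuousLinearMap.adjoint_inner_left]

theorem star_tensorOp [CompleteSpace E] [CompleteSpace F] (A : E →L[ℂ] E) (B : F →L[ℂ] F) :
    star (tensorOp A B) = tensorOp (star A) (star B) :=
  adjoint_tensorMap A B

theorem tensorOp_mul (A A' : E →L[ℂ] E) (B B' : F →L[ℂ] F) :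
    tensorOp (A * A') (B * B') = tensorOp A B * tensorOp A' B' :=
  tensorMap_comp A A' B B'

theorem tensorOp_tensorVec (A : E →L[ℂ] E) (B : F →L[ℂ] F) (x : E) (y : F) :
    tensorOp A B (tensorVec F x y) = tensorVec F (A x) (B y) :=
  tensorMap_tensorVec A B x y

/-- The unital algebra homomorphism `A ↦ A ⊗ I`. -/
def ampliation (E F : Type*) [NormedAddCommGroup E] [InnerProductSpace ℂ E]
    [NormedAddCommGroup F] [InnerProductSpace ℂ F] :
    (E →L[ℂ] E) →ₐ[ℂ] (HTensor E F →L[ℂ] HTensor E F) where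
  toFun A := tensorOp A 1
  map_one' := tensorMap_one
  map_mul' A A' := by
    rw [← tensorOp_mul, one_mul]
  map_zero' := by
    have h := tensorMap_smul_left (0 : ℂ) (0 : E →L[ℂ] E) (1 : F →L[ℂ] F)
    rwa [zero_smul, zero_smul] at h
  map_add' A A' := tensorMap_add_left A A' 1
  commutes' c := by
    rw [Algebra.algebraMap_eq_smul_one, Algebra.algebraMap_eq_smul_one]
    exact (tensorMap_smul_left c 1 1).trans (congrArg (fun A => c • A) tensorMap_one)

theorem ampliation_apply (A : E →L[ℂ] E) : ampliation E F A = tensorOp A 1 := rfl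

theorem norm_ampliation_le (A : E →L[ℂ] E) : ‖ampliation E F A‖ ≤ ‖A‖ := by
  refine (norm_tensorMap_le A 1).trans ?_
  exact mul_le_of_le_one_right (norm_nonneg _) ContinuousLinearMap.norm_id_le

end Tensor

/-! ### Sums in the weak operator topology -/

section WOT

variable {ι E F : Type*} [NormedAddCommGroup E] [InnerProductSpace ℂ E]
  [NormedAddCommGroup F] [InnerProductSpace ℂ F] [CompleteSpace F]

theorem hasSum_wot_iff {u : ι → E →L[ℂ] F} {S : E →L[ℂ] F} :
    HasSum (fun i => ContinuousLinearMapWOT.ofCLM (u i)) (ContinuousLinearMapWOT.ofCLM S) ↔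
      ∀ x y, HasSum (fun i => inner ℂ y (u i x)) (inner ℂ y (S x)) := by
  unfold HasSum
  rw [ContinuousLinearMapWOT.tendsto_iff_forall_inner_apply_tendsto]
  have : ∀ (s : Finset ι) (x : E) (y : F),
      inner ℂ y ((∑ i ∈ s, ContinuousLinearMapWOT.ofCLM (u i)) x) = ∑ i ∈ s, inner ℂ y (u i x) := by
    classical
    intro s x y
    induction s using Finset.induction_on with
    | empty => simp
    | insert a s ha ih =>
      rw [Finset.sum_insert ha, Finset.sum_insert ha, ← ih, ContinuousLinearMapWOT.add_apply,
        inner_add_right]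
      rfl
  simp only [this]
  rfl

theorem wotSum_eq {u : ι → E →L[ℂ] F} {S : E →L[ℂ] F}
    (h : ∀ x y, HasSum (fun i => inner ℂ y (u i x)) (inner ℂ y (S x))) : wotSum u = S := by
  rw [wotSum, (hasSum_wot_iff.2 h).tsum_eq]

theorem wotSummable_of_hasSum {u : ι → E →L[ℂ] F} {S : E →L[ℂ] F}
    (h : ∀ x y, HasSum (fun i => inner ℂ y (u i x)) (inner ℂ y (S x))) : WOTSummable u :=
  (hasSum_wot_iff.2 h).summable

theorem WOTSummable.hasSum_inner {u : ι → E →L[ℂ] F} (h : WOTSummable u) (x : E) (y : F) :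
    HasSum (fun i => inner ℂ y (u i x)) (inner ℂ y (wotSum u x)) :=
  hasSum_wot_iff.1 (Summable.hasSum h) x y

/-- A series of operators whose matrix coefficients are absolutely summable with a uniform bound
converges in the weak operator topology. -/
theorem exists_hasSum_inner {u : ι → E →L[ℂ] F} {C : ℝ} (hC : 0 ≤ C)
    (hs : ∀ x y, Summable fun i => ‖inner ℂ y (u i x)‖)
    (hb : ∀ x y, ∑' i, ‖inner ℂ y (u i x)‖ ≤ C * ‖x‖ * ‖y‖) :
    ∃ S : E →L[ℂ] F, ‖S‖ ≤ C ∧ ∀ x y, HasSum (fun i => inner ℂ y (u i x)) (inner ℂ y (S x)) := by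
  have hs' : ∀ x y, Summable fun i => inner ℂ (u i x) y := fun x y => by
    refine Summable.of_norm ?_
    simpa only [norm_inner_symm] using hs x y
  -- The summed form is conjugate-linear in `x` and bounded by `C`; the Riesz representation of `B
  -- x` is the value at `x` of the desired operator.
  let B : E →L⋆[ℂ] F →L[ℂ] ℂ := LinearMap.mkContinuous₂
    (LinearMap.mk₂'ₛₗ (starRingEnd ℂ) (RingHom.id ℂ) (fun x y => ∑' i, inner ℂ (u i x) y)
      (fun x x' y => by
        simp only [map_add, inner_add_left]
        exact (hs' x y).tsum_add (hs' x' y))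
      (fun c x y => by
        simp only [map_smul, inner_smul_left]
        exact tsum_mul_left)
      (fun x y y' => by
        simp only [inner_add_right]
        exact (hs' x y).tsum_add (hs' x y'))
      (fun c x y => by
        simp only [inner_smul_right]
        exact tsum_mul_left)) C (fun x y => by
        refine (norm_tsum_le_tsum_norm ?_).trans ?_
        · simpa only [norm_inner_symm] using hs x y
        · simpa only [norm_inner_symm] using hb x y)
  let S : E →L[ℂ] F :=
    ((InnerProductSpace.toDual ℂ F).symm.toContinuousLinearEquiv.toContinuousLinearMap).comp B
  have hS : ∀ x y, inner ℂ (S x) y = ∑' i, inner ℂ (u i x) y := fun x y =>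
    InnerProductSpace.toDual_symm_apply
  refine ⟨S, ContinuousLinearMap.opNorm_le_bound _ hC fun x => ?_, fun x y => ?_⟩
  · have : ‖S x‖ = ‖B x‖ :=
      (InnerProductSpace.toDual ℂ F).symm.norm_map (B x)
    rw [this]
    exact (B.le_opNorm x).trans
      (mul_le_mul_of_nonneg_right (LinearMap.mkContinuous₂_norm_le _ hC _) (norm_nonneg _))
  · have := (hs' x y).hasSum
    rw [← hS x y] at this
    simpa only [RCLike.star_def, inner_conj_symm] using this.star

end WOT

/-! ### Coordinates in the Hilbert tensor product with the Fock space -/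

section Coordinates

variable {n : ℕ} {H : Type*} [NormedAddCommGroup H] [InnerProductSpace ℂ H] [CompleteSpace H]

theorem fock_clm_ext {G : Type*} [NormedAddCommGroup G] [NormedSpace ℂ G]
    {A B : Fock n →L[ℂ] G} (h : ∀ α, A (e α) = B (e α)) : A = B := by
  refine lp.ext_continuousLinearMap (by norm_num) fun α => ?_
  ext
  exact h α

theorem norm_e (α : List (Fin n)) : ‖e α‖ = 1 := orthonormal_e.1 α

theorem inner_e (α β : List (Fin n)) : inner ℂ (e α) (e β) = if α = β then (1 : ℂ) else 0 :=
  orthonormal_iff_ite.1 orthonormal_e α β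

variable (H) in
/-- The isometry `y ↦ e_α ⊗ y`. -/
def coordIsometry (α : List (Fin n)) : H →ₗᵢ[ℂ] HTensor (Fock n) H where
  toLinearMap := (tensorVec H (e α)).toLinearMap
  norm_map' y := by
    change ‖tensorVec H (e α) y‖ = ‖y‖
    rw [tensorVec_apply, UniformSpace.Completion.norm_coe, TensorProduct.norm_tmul, norm_e,
      one_mul]

theorem coordIsometry_apply (α : List (Fin n)) (y : H) :
    coordIsometry H α y = tensorVec H (e α) y := rfl

theorem orthogonalFamily_coordIsometry :
    OrthogonalFamily ℂ (fun _ : List (Fin n) => H) (coordIsometry H) := by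
  intro α β hαβ x y
  rw [coordIsometry_apply, coordIsometry_apply, inner_tensorVec, inner_e, if_neg hαβ, zero_mul]

-- If `v` is orthogonal to all `e α ⊗ H`, then for fixed `y` the functional `x ↦ ⟨v, x ⊗ y⟩`
-- vanishes on the basis of the Fock space, hence everywhere. So the tensor product is an ℓ² space
-- of `H`-valued coordinates.
variable (H) in
theorem isHilbertSum_coordIsometry :
    IsHilbertSum ℂ (fun _ : List (Fin n) => H) (coordIsometry H) := by
  refine IsHilbertSum.mk orthogonalFamily_coordIsometry ?_
  rw [top_le_iff, Submodule.topologicalClosure_eq_top_iff, Submodule.eq_bot_iff]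
  intro v hv
  refine HTensor.ext_inner fun x y => ?_
  rw [inner_zero_left]
  have h : (innerSL ℂ v) ∘L (UniformSpace.Completion.toComplL ∘L
      (TensorProduct.mkL ℂ (Fock n) H).flip y) = 0 := by
    refine fock_clm_ext fun α => ?_
    have h1 : coordIsometry H α y ∈ ⨆ i, LinearMap.range (coordIsometry (n := n) H i).toLinearMap :=
      Submodule.mem_iSup_of_mem α ⟨y, rfl⟩
    exact Submodule.inner_left_of_mem_orthogonal h1 hv
  exact congrArg (fun A : Fock n →L[ℂ] ℂ => A x) h

variable (H) in
/-- The coordinate map `e_α ⊗ y ↦ y`. -/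
def coord (α : List (Fin n)) : HTensor (Fock n) H →L[ℂ] H :=
  (tensorVec H (e α)).adjoint

theorem inner_coord_right (α : List (Fin n)) (y : H) (v : HTensor (Fock n) H) :
    inner ℂ y (coord H α v) = inner ℂ (tensorVec H (e α) y) v :=
  ContinuousLinearMap.adjoint_inner_right _ _ _

theorem coord_tensorVec (α β : List (Fin n)) (y : H) :
    coord H α (tensorVec H (e β) y) = if α = β then y else 0 := by
  refine ext_inner_left ℂ fun z => ?_
  rw [inner_coord_right, inner_tensorVec, inner_e]
  split_ifs <;> simp

theorem coord_linearIsometry (w : lp (fun _ : List (Fin n) => H) 2) (α : List (Fin n)) :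
    coord H α ((isHilbertSum_coordIsometry H).linearIsometryEquiv.symm w) = w α := by
  have h := ((isHilbertSum_coordIsometry H).hasSum_linearIsometryEquiv_symm w).mapL (coord H α)
  simp only [coordIsometry_apply, coord_tensorVec] at h
  refine h.unique ?_
  convert hasSum_single α ?_ using 1
  · rw [if_pos rfl]
  · exact fun β hβ => if_neg (Ne.symm hβ)

theorem hasSum_norm_coord_sq (v : HTensor (Fock n) H) :
    HasSum (fun α => ‖coord H α v‖ ^ 2) (‖v‖ ^ 2) := by
  obtain ⟨w, rfl⟩ := (isHilbertSum_coordIsometry (n := n) H).linearIsometryEquiv.symm.surjective v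
  simp only [coord_linearIsometry, LinearIsometryEquiv.norm_map]
  have h := lp.hasSum_norm (p := 2) (by norm_num) w
  simpa using h

theorem tsum_norm_coord_sq (v : HTensor (Fock n) H) :
    ∑' α, ENNReal.ofReal (‖coord H α v‖ ^ 2) = ENNReal.ofReal (‖v‖ ^ 2) := by
  rw [← (hasSum_norm_coord_sq v).tsum_eq,
    ENNReal.ofReal_tsum_of_nonneg (fun _ => by positivity) (hasSum_norm_coord_sq v).summable]

theorem coord_ext {v w : HTensor (Fock n) H} (h : ∀ α, coord H α v = coord H α w) : v = w := by
  have h1 := hasSum_norm_coord_sq (v - w)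
  simp only [map_sub, h, sub_self, norm_zero, ne_eq, OfNat.ofNat_ne_zero, not_false_eq_true,
    zero_pow] at h1
  have h2 := h1.unique hasSum_zero
  simpa [sub_eq_zero] using h2

theorem summable_tensorVec {u : List (Fin n) → H} (h : Summable fun α => ‖u α‖ ^ 2) :
    Summable fun α => tensorVec H (e α) (u α) :=
  (orthogonalFamily_coordIsometry.summable_iff_norm_sq_summable u).2 h

theorem coord_of_hasSum {u : List (Fin n) → H} {v : HTensor (Fock n) H}
    (h : HasSum (fun α => tensorVec H (e α) (u α)) v) (α : List (Fin n)) :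
    coord H α v = u α := by
  have h := h.mapL (coord H α)
  simp only [coord_tensorVec] at h
  refine h.unique ?_
  convert hasSum_single α ?_ using 1
  · rw [if_pos rfl]
  · exact fun β hβ => if_neg (Ne.symm hβ)

/-- The adjoint of a weighted shift of basis vectors moves coordinates backwards. This one rule
serves the W_i, the Λ_α and the operators `1 ⊗ B`. -/
theorem coord_tensorOp_star (A : Fock n →L[ℂ] Fock n) (B : H →L[ℂ] H) {γ δ : List (Fin n)}
    {c : ℝ} (h : A (e γ) = (c : ℂ) • e δ) (v : HTensor (Fock n) H) :
    coord H γ (tensorOp (star A) (star B) v) = (c : ℂ) • star B (coord H δ v) := by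
  refine ext_inner_left ℂ fun y => ?_
  rw [inner_coord_right, ← star_tensorOp, ContinuousLinearMap.star_eq_adjoint,
    ContinuousLinearMap.adjoint_inner_right, tensorOp_tensorVec, h, tensorVec_smul,
    inner_smul_right, ContinuousLinearMap.star_eq_adjoint,
    ContinuousLinearMap.adjoint_inner_right, inner_coord_right,
    smul_apply, inner_smul_left, Complex.conj_ofReal]

variable (f : PosRegular n) (m : ℕ)

/-- The last letter of `α` acts first, so the appended word comes out reversed; the quotients under
the root telescope. -/
theorem mono_Lam_e (α γ : List (Fin n)) : mono (Lam f m) α (e γ) =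
    ((√(f.b m γ / f.b m (γ ++ α.reverse)) : ℝ) : ℂ) • e (γ ++ α.reverse) := by
  induction α with
  | nil => simp [mono_nil, div_self (f.b_pos m γ).ne']
  | cons i α ih =>
    rw [mono_cons, mul_apply_eq_comp, ih, map_smul, Lam_e, smul_smul, ← Complex.ofReal_mul,
      ← Real.sqrt_mul (div_nonneg (f.b_nonneg _ _) (f.b_nonneg _ _)),
      div_mul_div_cancel₀ (f.b_pos m _).ne', List.reverse_cons, List.append_assoc]

theorem star_mono_Lam_e (α δ : List (Fin n)) : star (mono (Lam f m) α) (e δ) =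
    if α.reverse <:+ δ then
      ((√(f.b m (δ.take (δ.length - α.length)) / f.b m δ) : ℝ) : ℂ) •
        e (δ.take (δ.length - α.length)) else 0 := by
  have hext : ∀ v w : Fock n, (∀ γ, inner ℂ v (e γ) = inner ℂ w (e γ)) → v = w := by
    intro v w h
    have : innerSL ℂ v = innerSL ℂ w := fock_clm_ext fun γ => by simpa using h γ
    refine ext_inner_right ℂ fun u => ?_
    simpa using congrArg (fun A : Fock n →L[ℂ] ℂ => A u) this
  refine hext _ _ fun γ => ?_
  rw [ContinuousLinearMap.star_eq_adjoint, ContinuousLinearMap.adjoint_inner_left, mono_Lam_e,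
    inner_smul_right, inner_e]
  split_ifs with h1 h2 h2
  · subst h1
    simp [norm_e]
  · exact absurd ⟨γ, h1.symm⟩ h2
  · rw [inner_smul_left, inner_e, if_neg, mul_zero, mul_zero]
    intro h3
    obtain ⟨γ', rfl⟩ := h2
    simp at h3
    exact h1 (by rw [h3])
  · simp

end Coordinates

/-! ### Auxiliary estimates -/

section Auxiliary

theorem sum_le_of_tsum_ofReal_le {ι : Type*} {p : ι → ℝ} {P : ℝ} (hp : ∀ i, 0 ≤ p i)
    (hP : 0 ≤ P) (h : ∑' i, ENNReal.ofReal (p i) ≤ ENNReal.ofReal P) (s : Finset ι) :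
    ∑ i ∈ s, p i ≤ P := by
  rw [← ENNReal.ofReal_le_ofReal_iff hP, ENNReal.ofReal_sum_of_nonneg fun i _ => hp i]
  exact (ENNReal.sum_le_tsum s).trans h

theorem summable_of_tsum_ofReal_le {ι : Type*} {p : ι → ℝ} {P : ℝ} (hp : ∀ i, 0 ≤ p i)
    (hP : 0 ≤ P) (h : ∑' i, ENNReal.ofReal (p i) ≤ ENNReal.ofReal P) : Summable p :=
  summable_of_sum_le hp (sum_le_of_tsum_ofReal_le hp hP h)

/-- The Cauchy–Schwarz criterion for convergence in the weak operator topology. -/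
theorem exists_hasSum_inner_of_cauchySchwarz {ι E F : Type*} [NormedAddCommGroup E]
    [InnerProductSpace ℂ E] [NormedAddCommGroup F] [InnerProductSpace ℂ F] [CompleteSpace F]
    {u : ι → E →L[ℂ] F} {p : E → ι → ℝ} {q : F → ι → ℝ} {P Q : ℝ} (hP : 0 ≤ P) (hQ : 0 ≤ Q)
    (hu : ∀ x y i, ‖inner ℂ y (u i x)‖ ≤ p x i * q y i)
    (hp : ∀ x, ∑' i, ENNReal.ofReal (p x i ^ 2) ≤ ENNReal.ofReal ((P * ‖x‖) ^ 2))
    (hq : ∀ y, ∑' i, ENNReal.ofReal (q y i ^ 2) ≤ ENNReal.ofReal ((Q * ‖y‖) ^ 2)) :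
    ∃ S : E →L[ℂ] F, ‖S‖ ≤ P * Q ∧
      ∀ x y, HasSum (fun i => inner ℂ y (u i x)) (inner ℂ y (S x)) := by
  have key : ∀ x y (s : Finset ι), ∑ i ∈ s, ‖inner ℂ y (u i x)‖ ≤ P * Q * ‖x‖ * ‖y‖ := by
    intro x y s
    calc ∑ i ∈ s, ‖inner ℂ y (u i x)‖ ≤ ∑ i ∈ s, p x i * q y i :=
          Finset.sum_le_sum fun i _ => hu x y i
      _ ≤ √(∑ i ∈ s, p x i ^ 2) * √(∑ i ∈ s, q y i ^ 2) := Real.sum_mul_le_sqrt_mul_sqrt _ _ _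
      _ ≤ √((P * ‖x‖) ^ 2) * √((Q * ‖y‖) ^ 2) := by
          gcongr
          · exact sum_le_of_tsum_ofReal_le (fun i => sq_nonneg _) (sq_nonneg _) (hp x) s
          · exact sum_le_of_tsum_ofReal_le (fun i => sq_nonneg _) (sq_nonneg _) (hq y) s
      _ = P * Q * ‖x‖ * ‖y‖ := by
          rw [Real.sqrt_sq (by positivity), Real.sqrt_sq (by positivity)]
          ring
  have hs : ∀ x y, Summable fun i => ‖inner ℂ y (u i x)‖ := fun x y =>
    summable_of_sum_le (fun _ => norm_nonneg _) (key x y)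
  exact exists_hasSum_inner (by positivity) hs
    fun x y => (hs x y).tsum_le_of_sum_le (key x y)

/-- Fekete's lemma for `log u`. A zero of `u` forces all later terms to vanish, and if `log (u k) /
k` is unbounded below the limit is `0`. -/
theorem exists_tendsto_rpow_of_submultiplicative {u : ℕ → ℝ} (h0 : ∀ k, 0 ≤ u k)
    (hsub : ∀ i j, u (i + j) ≤ u i * u j) :
    ∃ s, Tendsto (fun k : ℕ => u k ^ (1 / (2 * (k : ℝ)))) atTop (𝓝 s) := by
  by_cases hz : ∃ k, u k = 0
  · obtain ⟨k, hk⟩ := hz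
    refine ⟨0, tendsto_const_nhds.congr' ?_⟩
    filter_upwards [eventually_ge_atTop k, eventually_ge_atTop 1] with j hj hj1
    have : u j = 0 := by
      refine le_antisymm ?_ (h0 j)
      obtain ⟨i, rfl⟩ := Nat.exists_eq_add_of_le hj
      simpa [hk] using hsub k i
    rw [this, Real.zero_rpow]
    have : (0 : ℝ) < j := by exact_mod_cast hj1
    positivity
  · push Not at hz
    have hpos : ∀ k, 0 < u k := fun k => lt_of_le_of_ne (h0 k) (hz k).symm
    have hadd : Subadditive fun k => Real.log (u k) := fun i j => by
      rw [← Real.log_mul (hz i) (hz j)]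
      exact Real.log_le_log (hpos _) (hsub i j)
    have hexp : ∀ k : ℕ, u k ^ (1 / (2 * (k : ℝ))) = Real.exp (Real.log (u k) / k * (1 / 2)) := by
      intro k
      rw [Real.rpow_def_of_pos (hpos k)]
      congr 1
      rw [one_div, mul_inv]
      ring
    simp only [hexp]
    by_cases hb : BddBelow (Set.range fun k : ℕ => Real.log (u k) / k)
    · exact ⟨_, (Real.continuous_exp.tendsto _).comp ((hadd.tendsto_lim hb).mul_const _)⟩
    · refine ⟨0, Real.tendsto_exp_atBot.comp (Tendsto.atBot_mul_const (by norm_num) ?_)⟩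
      rw [tendsto_atBot]
      intro L
      rw [not_bddBelow_iff] at hb
      -- The minimum with `0` excludes `k = 0`, where the quotient has the default value `0`.
      obtain ⟨_, ⟨k, rfl⟩, hk⟩ := hb (min L 0)
      have hk0 : k ≠ 0 := by
        rintro rfl
        simp at hk
      filter_upwards [hadd.eventually_div_lt_of_div_lt hk0 (hk.trans_le (min_le_left _ _))]
        with p hp using hp.le

theorem exists_lt_one_tendsto_rpow {u : ℕ → ℝ} (h0 : ∀ k, 0 ≤ u k)
    (hsub : ∀ i j, u (i + j) ≤ u i * u j) {r : ℝ} (hr0 : 0 ≤ r) (hr1 : r < 1)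
    (hb : ∀ k, u k ≤ (r ^ 2) ^ k) :
    ∃ s < 1, Tendsto (fun k : ℕ => u k ^ (1 / (2 * (k : ℝ)))) atTop (𝓝 s) := by
  obtain ⟨s, hs⟩ := exists_tendsto_rpow_of_submultiplicative h0 hsub
  refine ⟨s, lt_of_le_of_lt (le_of_tendsto hs ?_) hr1, hs⟩
  filter_upwards [eventually_ge_atTop 1] with k hk
  have hk' : (0 : ℝ) < k := by exact_mod_cast hk
  calc u k ^ (1 / (2 * (k : ℝ))) ≤ ((r ^ 2) ^ k) ^ (1 / (2 * (k : ℝ))) :=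
        Real.rpow_le_rpow (h0 k) (hb k) (by positivity)
    _ = r := by
        rw [← pow_mul, ← Real.rpow_natCast, ← Real.rpow_mul hr0]
        push_cast
        rw [mul_one_div_cancel (by positivity), Real.rpow_one]

end Auxiliary

/-! ### The completely positive map of a row contraction -/

section RowBound

variable {n : ℕ} {H : Type*} [NormedAddCommGroup H] [InnerProductSpace ℂ H] [CompleteSpace H]

/-- The form `h ↦ ‖h‖²`. -/
def normForm (h : H) : ℝ≥0∞ := ENNReal.ofReal (‖h‖ ^ 2)

/-- The form `h ↦ ⟨h, Y h⟩`. -/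
def opForm (Y : H →L[ℂ] H) (h : H) : ℝ≥0∞ := ENNReal.ofReal (RCLike.re (inner ℂ h (Y h)))

theorem opForm_one : opForm (1 : H →L[ℂ] H) = normForm := by
  ext h
  simp only [opForm, normForm, one_apply_eq_self]
  congr 1
  exact inner_self_eq_norm_sq (𝕜 := ℂ) h

theorem opForm_add {Y Z : H →L[ℂ] H} (hY : 0 ≤ Y) (hZ : 0 ≤ Z) :
    opForm (Y + Z) = opForm Y + opForm Z := by
  ext h
  rw [ContinuousLinearMap.nonneg_iff_isPositive] at hY hZ
  simp only [opForm, Pi.add_apply]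
  rw [← ENNReal.ofReal_add (hY.re_inner_nonneg_right h) (hZ.re_inner_nonneg_right h), add_apply,
    inner_add_right, map_add]

theorem opForm_le (Y : H →L[ℂ] H) : opForm Y ≤ ENNReal.ofReal ‖Y‖ • normForm := by
  intro h
  rw [Pi.smul_apply, smul_eq_mul, normForm, ← ENNReal.ofReal_mul (norm_nonneg _)]
  refine ENNReal.ofReal_le_ofReal ?_
  calc RCLike.re (inner ℂ h (Y h)) ≤ ‖h‖ * ‖Y h‖ := re_inner_le_norm _ _
    _ ≤ ‖h‖ * (‖Y‖ * ‖h‖) := by gcongr; exact Y.le_opNorm h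
    _ = ‖Y‖ * ‖h‖ ^ 2 := by ring

theorem norm_le_of_opForm_le {Y : H →L[ℂ] H} (hY : 0 ≤ Y) {c : ℝ} (hc : 0 ≤ c)
    (h : opForm Y ≤ ENNReal.ofReal c • normForm) : ‖Y‖ ≤ c := by
  rw [CStarAlgebra.norm_le_iff_le_algebraMap Y hc hY, ← sub_nonneg,
    ContinuousLinearMap.nonneg_iff_isPositive, ContinuousLinearMap.isPositive_def]
  rw [ContinuousLinearMap.nonneg_iff_isPositive] at hY
  have hsa : IsSelfAdjoint (algebraMap ℝ (H →L[ℂ] H) c - Y) :=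
    (IsSelfAdjoint.algebraMap _ (IsSelfAdjoint.all c)).sub hY.isSelfAdjoint
  refine ⟨hsa.isSymmetric, fun x => ?_⟩
  have hx := h x
  rw [Pi.smul_apply, smul_eq_mul, normForm, ← ENNReal.ofReal_mul hc, opForm,
    ENNReal.ofReal_le_ofReal_iff (by positivity)] at hx
  rw [ContinuousLinearMap.reApplyInnerSelf_apply, Algebra.algebraMap_eq_smul_one, sub_apply,
    inner_sub_left, map_sub, inner_re_symm (𝕜 := ℂ) (Y x) x, sub_nonneg]
  refine hx.trans (le_of_eq ?_)
  have h2 : ((c • (1 : H →L[ℂ] H)) x) = (c : ℂ) • x := by simp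
  rw [h2, inner_smul_left, Complex.conj_ofReal, RCLike.re_eq_complex_re, Complex.re_ofReal_mul,
    ← RCLike.re_eq_complex_re, inner_self_eq_norm_sq (𝕜 := ℂ) x]

variable (f : PosRegular n) (T : Fin n → H →L[ℂ] H)

/-- The bound `∑ a_α T_α T_α^* ≤ c² I`, as an inequality of forms. -/
def RowBound (c : ℝ) : Prop := formMap f T normForm ≤ ENNReal.ofReal (c ^ 2) • normForm

variable {f T} {c : ℝ}

theorem RowBound.tsum_le (hT : RowBound f T c) (x : H) :
    ∑' α, ENNReal.ofReal ((√(f.coeff α) * ‖star (mono T α) x‖) ^ 2) ≤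
      ENNReal.ofReal ((c * ‖x‖) ^ 2) := by
  have h := hT x
  rw [Pi.smul_apply, smul_eq_mul, normForm, ← ENNReal.ofReal_mul (sq_nonneg c), ← mul_pow] at h
  refine le_trans (le_of_eq ?_) h
  refine tsum_congr fun α => ?_
  rw [normForm, ← ENNReal.ofReal_mul (f.coeff_nonneg α), mul_pow, Real.sq_sqrt (f.coeff_nonneg α)]

theorem inner_phiTerm (Y : H →L[ℂ] H) (α : List (Fin n)) (x y : H) :
    inner ℂ y (((f.coeff α : ℂ) • (mono T α * Y * star (mono T α))) x) =
      (f.coeff α : ℂ) * inner ℂ (star (mono T α) y) (Y (star (mono T α) x)) := by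
  rw [smul_apply, inner_smul_right, ContinuousLinearMap.star_eq_adjoint,
    ContinuousLinearMap.adjoint_inner_left]
  rfl

/-- Cauchy–Schwarz with `f.coeff α` split into two square roots. Under a row bound the series for
Φ(Y) therefore converges for every `Y`, and `Phi` is its actual sum. -/
theorem RowBound.exists_hasSum_phi (hc : 0 ≤ c) (hT : RowBound f T c) (Y : H →L[ℂ] H) :
    ∃ S : H →L[ℂ] H, ∀ x y, HasSum (fun α => inner ℂ y
      (((f.coeff α : ℂ) • (mono T α * Y * star (mono T α))) x)) (inner ℂ y (S x)) := by
  have hu : ∀ x y α, ‖inner ℂ y (((f.coeff α : ℂ) • (mono T α * Y * star (mono T α))) x)‖ ≤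
      √(f.coeff α) * ‖star (mono T α) x‖ * ‖Y‖ * (√(f.coeff α) * ‖star (mono T α) y‖) := by
    intro x y α
    rw [inner_phiTerm, norm_mul, Complex.norm_real, Real.norm_of_nonneg (f.coeff_nonneg α)]
    calc f.coeff α * ‖inner ℂ (star (mono T α) y) (Y (star (mono T α) x))‖
        ≤ f.coeff α * (‖star (mono T α) y‖ * (‖Y‖ * ‖star (mono T α) x‖)) := by
          refine mul_le_mul_of_nonneg_left ?_ (f.coeff_nonneg α)
          exact (norm_inner_le_norm _ _).trans
            (mul_le_mul_of_nonneg_left (Y.le_opNorm _) (norm_nonneg _))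
      _ = √(f.coeff α) * √(f.coeff α) *
          (‖star (mono T α) y‖ * (‖Y‖ * ‖star (mono T α) x‖)) := by
          rw [Real.mul_self_sqrt (f.coeff_nonneg α)]
      _ = _ := by ring
  have hp : ∀ x, ∑' α, ENNReal.ofReal ((√(f.coeff α) * ‖star (mono T α) x‖ * ‖Y‖) ^ 2) ≤
      ENNReal.ofReal ((c * ‖Y‖ * ‖x‖) ^ 2) := by
    intro x
    simp only [mul_pow _ ‖Y‖ 2, ENNReal.ofReal_mul' (sq_nonneg ‖Y‖), ENNReal.tsum_mul_right]
    rw [mul_right_comm c, mul_pow _ ‖Y‖, ENNReal.ofReal_mul' (sq_nonneg ‖Y‖)]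
    exact mul_le_mul_left (hT.tsum_le x) _
  obtain ⟨S, -, hS⟩ := exists_hasSum_inner_of_cauchySchwarz (by positivity) hc hu hp hT.tsum_le
  exact ⟨S, hS⟩

theorem RowBound.hasSum_phi (hc : 0 ≤ c) (hT : RowBound f T c) (Y : H →L[ℂ] H) (x y : H) :
    HasSum (fun α => (f.coeff α : ℂ) * inner ℂ (star (mono T α) y) (Y (star (mono T α) x)))
      (inner ℂ y (Phi f T Y x)) := by
  obtain ⟨S, hS⟩ := hT.exists_hasSum_phi hc Y
  rw [show Phi f T Y = S from wotSum_eq hS]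
  simpa only [inner_phiTerm] using hS x y

theorem RowBound.hasSum_re_phi (hc : 0 ≤ c) (hT : RowBound f T c) (Y : H →L[ℂ] H) (x : H) :
    HasSum (fun α => f.coeff α *
      RCLike.re (inner ℂ (star (mono T α) x) (Y (star (mono T α) x))))
      (RCLike.re (inner ℂ x (Phi f T Y x))) := by
  have h := ((Complex.hasSum_iff _ _).1 (hT.hasSum_phi hc Y x x)).1
  simp only [Complex.re_ofReal_mul] at h
  exact h

theorem RowBound.phi_nonneg (hc : 0 ≤ c) (hT : RowBound f T c) {Y : H →L[ℂ] H} (hY : 0 ≤ Y) :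
    0 ≤ Phi f T Y := by
  rw [ContinuousLinearMap.nonneg_iff_isPositive] at hY ⊢
  refine (ContinuousLinearMap.isPositive_def).2 ⟨?_, fun x => ?_⟩
  · intro x y
    change inner ℂ (Phi f T Y x) y = inner ℂ x (Phi f T Y y)
    have h1 := (hT.hasSum_phi hc Y x y).star
    have h2 := hT.hasSum_phi hc Y y x
    rw [RCLike.star_def, inner_conj_symm] at h1
    refine h1.unique ?_
    convert h2 using 2 with α
    rw [map_mul, Complex.conj_ofReal, inner_conj_symm]
    congr 1
    exact hY.isSelfAdjoint.isSymmetric _ _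
  · rw [ContinuousLinearMap.reApplyInnerSelf_apply, inner_re_symm]
    exact (hT.hasSum_re_phi hc Y x).nonneg
      fun α => mul_nonneg (f.coeff_nonneg α) (hY.re_inner_nonneg_right _)

/-- The bridge between Φ on positive operators and its action on `ℝ≥0∞`-valued forms, where sums may
be rearranged freely. -/
theorem RowBound.formMap_opForm (hc : 0 ≤ c) (hT : RowBound f T c) {Y : H →L[ℂ] H}
    (hY : 0 ≤ Y) : formMap f T (opForm Y) = opForm (Phi f T Y) := by
  ext x
  rw [ContinuousLinearMap.nonneg_iff_isPositive] at hY
  have h := hT.hasSum_re_phi hc Y x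
  rw [opForm, ← h.tsum_eq, ENNReal.ofReal_tsum_of_nonneg
    (fun α => mul_nonneg (f.coeff_nonneg α) (hY.re_inner_nonneg_right _)) h.summable]
  refine tsum_congr fun α => ?_
  rw [ENNReal.ofReal_mul (f.coeff_nonneg α), opForm]

theorem RowBound.iterate_phi_nonneg (hc : 0 ≤ c) (hT : RowBound f T c) {Y : H →L[ℂ] H}
    (hY : 0 ≤ Y) (j : ℕ) : 0 ≤ (Phi f T)^[j] Y := by
  induction j with
  | zero => exact hY
  | succ j ih =>
    rw [Function.iterate_succ_apply']
    exact hT.phi_nonneg hc ih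

theorem RowBound.iterate_formMap_opForm (hc : 0 ≤ c) (hT : RowBound f T c) {Y : H →L[ℂ] H}
    (hY : 0 ≤ Y) (j : ℕ) : (formMap f T)^[j] (opForm Y) = opForm ((Phi f T)^[j] Y) := by
  induction j with
  | zero => rfl
  | succ j ih =>
    rw [Function.iterate_succ_apply', Function.iterate_succ_apply', ih,
      hT.formMap_opForm hc (hT.iterate_phi_nonneg hc hY j)]

theorem iterate_formMap_mono (j : ℕ) {p q : H → ℝ≥0∞} (h : p ≤ q) :
    (formMap f T)^[j] p ≤ (formMap f T)^[j] q :=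
  Monotone.iterate (fun _ _ h => formMap_mono f T h) j h

theorem iterate_formMap_smul (j : ℕ) (a : ℝ≥0∞) (q : H → ℝ≥0∞) :
    (formMap f T)^[j] (a • q) = a • (formMap f T)^[j] q :=
  (Function.Commute.iterate_left (fun q => formMap_smul f T a q) j) q

theorem iterate_formMap_add (j : ℕ) (p q : H → ℝ≥0∞) :
    (formMap f T)^[j] (p + q) = (formMap f T)^[j] p + (formMap f T)^[j] q := by
  induction j with
  | zero => rfl
  | succ j ih => simp only [Function.iterate_succ_apply', ih, formMap_add]

theorem RowBound.iterate_formMap_normForm_le (hT : RowBound f T c) (j : ℕ) :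
    (formMap f T)^[j] normForm ≤ ENNReal.ofReal ((c ^ 2) ^ j) • normForm := by
  induction j with
  | zero => simp
  | succ j ih =>
    rw [Function.iterate_succ_apply]
    refine (iterate_formMap_mono j hT).trans ?_
    rw [iterate_formMap_smul, pow_succ' (c ^ 2), ENNReal.ofReal_mul (sq_nonneg c), mul_smul]
    exact fun h => mul_le_mul_right (ih h) _

theorem RowBound.norm_iterate_phi_le (hc : 0 ≤ c) (hT : RowBound f T c) (j : ℕ) :
    ‖(Phi f T)^[j] 1‖ ≤ (c ^ 2) ^ j := by
  refine norm_le_of_opForm_le (hT.iterate_phi_nonneg hc zero_le_one j) (by positivity) ?_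
  rw [← hT.iterate_formMap_opForm hc zero_le_one j, opForm_one]
  exact hT.iterate_formMap_normForm_le j

/-- By positivity of Φ, from Φ^j(I) ≤ ‖Φ^j(I)‖ I one gets Φ^(i+j)(I) ≤ ‖Φ^j(I)‖ Φ^i(I). This is the
submultiplicativity behind the spectral radius. -/
theorem RowBound.norm_iterate_phi_add_le (hc : 0 ≤ c) (hT : RowBound f T c) (i j : ℕ) :
    ‖(Phi f T)^[i + j] 1‖ ≤ ‖(Phi f T)^[i] 1‖ * ‖(Phi f T)^[j] 1‖ := by
  refine norm_le_of_opForm_le (hT.iterate_phi_nonneg hc zero_le_one _) (by positivity) ?_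
  rw [← hT.iterate_formMap_opForm hc zero_le_one, opForm_one, Function.iterate_add_apply]
  have h : ∀ j, (formMap f T)^[j] normForm ≤ ENNReal.ofReal ‖(Phi f T)^[j] 1‖ • normForm := by
    intro j
    rw [← opForm_one, hT.iterate_formMap_opForm hc zero_le_one, opForm_one]
    exact opForm_le _
  refine (iterate_formMap_mono i (h j)).trans ?_
  rw [iterate_formMap_smul, mul_comm, ENNReal.ofReal_mul (norm_nonneg _), mul_smul]
  exact fun x => mul_le_mul_right (h i x) _

theorem RowBound.exists_jointSpectralRadius (hc : 0 ≤ c) (hc1 : c < 1) (hT : RowBound f T c) :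
    ∃ s < 1, HasJointSpectralRadius f T s :=
  exists_lt_one_tendsto_rpow (fun _ => norm_nonneg _) (hT.norm_iterate_phi_add_le hc) hc hc1
    (hT.norm_iterate_phi_le hc)

theorem RowBound.tendsto_iterate_formMap (hc : 0 ≤ c) (hc1 : c < 1) (hT : RowBound f T c)
    (h : H) : Tendsto (fun j => (formMap f T)^[j] normForm h) atTop (𝓝 0) := by
  have h1 : Tendsto (fun j => ENNReal.ofReal ((c ^ 2) ^ j * ‖h‖ ^ 2)) atTop (𝓝 0) := by
    have := (tendsto_pow_atTop_nhds_zero_of_lt_one (sq_nonneg c)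
      (pow_lt_one₀ hc hc1 two_ne_zero)).mul_const (‖h‖ ^ 2)
    rw [zero_mul] at this
    simpa using ENNReal.tendsto_ofReal this
  refine tendsto_of_tendsto_of_tendsto_of_le_of_le tendsto_const_nhds h1 (fun _ => zero_le)
    fun j => ?_
  rw [ENNReal.ofReal_mul (by positivity)]
  exact hT.iterate_formMap_normForm_le j h

theorem IsPure.tendsto_iterate_formMap (hc : 0 ≤ c) (hT : RowBound f T c) (hp : IsPure f T)
    (h : H) : Tendsto (fun j => (formMap f T)^[j] normForm h) atTop (𝓝 0) := by
  simp only [← opForm_one, hT.iterate_formMap_opForm hc zero_le_one]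
  have h1 : Tendsto (fun j => RCLike.re (inner ℂ h (((Phi f T)^[j] 1) h))) atTop (𝓝 0) := by
    have h2 := (RCLike.continuous_re.tendsto _).comp
      ((tendsto_const_nhds (x := h)).inner (𝕜 := ℂ) (hp h))
    rw [inner_zero_right, map_zero] at h2
    exact h2
  simpa [opForm] using ENNReal.tendsto_ofReal h1

variable {m : ℕ}

/-- Only the inequality Φ(I) ≤ I is used, that is, the condition `k = 1`, available since `1 ≤ m`.
-/
theorem rowBound_of_mem_domain (hm : 1 ≤ m) (hT : T ∈ domain f m H) : RowBound f T 1 := by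
  obtain ⟨hs, hd⟩ := hT
  intro x
  have h1 := hd 1 le_rfl hm
  change 0 ≤ 1 - Phi f T 1 at h1
  rw [ContinuousLinearMap.nonneg_iff_isPositive] at h1
  have hphi : Phi f T 1 = wotSum fun α => (f.coeff α : ℂ) • (mono T α * star (mono T α)) := by
    simp only [Phi, mul_one]
  have h2 := hs.hasSum_inner x x
  rw [← hphi] at h2
  have h3 := ((Complex.hasSum_iff _ _).1 h2).1
  have h4 : ∀ α, (inner ℂ x (((f.coeff α : ℂ) • (mono T α * star (mono T α))) x)).re =
      f.coeff α * ‖star (mono T α) x‖ ^ 2 := by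
    intro α
    have := inner_phiTerm (f := f) (T := T) 1 α x x
    rw [mul_one] at this
    rw [this, Complex.re_ofReal_mul]
    congr 1
    exact inner_self_eq_norm_sq (𝕜 := ℂ) _
  simp only [h4] at h3
  have h5 : (inner ℂ x (Phi f T 1 x)).re ≤ ‖x‖ ^ 2 := by
    have := h1.re_inner_nonneg_right x
    rw [sub_apply, inner_sub_right, map_sub, sub_nonneg, one_apply_eq_self,
      inner_self_eq_norm_sq (𝕜 := ℂ)] at this
    exact this
  rw [Pi.smul_apply, one_pow, ENNReal.ofReal_one, one_smul, normForm]
  refine le_trans (le_of_eq ?_) (ENNReal.ofReal_le_ofReal h5)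
  rw [← h3.tsum_eq, ENNReal.ofReal_tsum_of_nonneg
    (fun α => mul_nonneg (f.coeff_nonneg α) (sq_nonneg _)) h3.summable]
  refine tsum_congr fun α => ?_
  rw [ENNReal.ofReal_mul (f.coeff_nonneg α), normForm]

theorem mono_scale (r : ℝ) (T : Fin n → H →L[ℂ] H) (α : List (Fin n)) :
    mono (scale r T) α = ((r ^ α.length : ℝ) : ℂ) • mono T α := by
  induction α with
  | nil => simp [mono_nil]
  | cons i α ih =>
    rw [mono_cons, mono_cons, ih, scale, smul_mul_smul_comm, List.length_cons, pow_succ']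
    push_cast
    rfl

theorem norm_star_mono_scale {r : ℝ} (hr : 0 ≤ r) (T : Fin n → H →L[ℂ] H) (α : List (Fin n))
    (x : H) : ‖star (mono (scale r T) α) x‖ = r ^ α.length * ‖star (mono T α) x‖ := by
  rw [mono_scale, star_smul, smul_apply, norm_smul, norm_star, Complex.norm_real,
    Real.norm_of_nonneg (by positivity)]

/-- Words with nonzero coefficient have length at least one, so r^(2|α|) ≤ r². This is where radial
scaling gains strictness. -/
theorem RowBound.scale (hT : RowBound f T 1) {r : ℝ} (hr : 0 ≤ r) (hr1 : r ≤ 1) :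
    RowBound f (scale r T) r := by
  intro x
  have hx := hT x
  rw [one_pow, ENNReal.ofReal_one, one_smul] at hx
  refine le_trans ?_ (mul_le_mul_right hx (ENNReal.ofReal (r ^ 2)))
  rw [formMap, formMap, ← ENNReal.tsum_mul_left]
  refine ENNReal.tsum_le_tsum fun α => ?_
  rcases eq_or_ne α [] with rfl | hα
  · simp [f.coeff_nil]
  rw [mul_left_comm]
  refine mul_le_mul_right ?_ _
  rw [normForm, normForm, ← ENNReal.ofReal_mul (sq_nonneg r), norm_star_mono_scale hr]
  refine ENNReal.ofReal_le_ofReal ?_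
  rw [mul_pow, ← pow_mul]
  refine mul_le_mul_of_nonneg_right (pow_le_pow_of_le_one hr hr1 ?_) (sq_nonneg _)
  have := List.length_pos_iff.2 hα
  omega

theorem defect_nonneg (hT : T ∈ domain f m H) {k : ℕ} (hk : k ≤ m) : 0 ≤ defect f T k := by
  rcases Nat.eq_zero_or_pos k with rfl | h
  · exact zero_le_one (α := H →L[ℂ] H)
  · exact hT.2 k h hk

theorem norm_Delta_sq (hT : T ∈ domain f m H) (x : H) :
    ENNReal.ofReal (‖Delta f m T x‖ ^ 2) = opForm (defect f T m) x := by
  have h0 : 0 ≤ Delta f m T := CFC.sqrt_nonneg _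
  have h1 : Delta f m T * Delta f m T = defect f T m :=
    CFC.sqrt_mul_sqrt_self _ (defect_nonneg hT le_rfl)
  rw [ContinuousLinearMap.nonneg_iff_isPositive] at h0
  rw [opForm, ← h1, mul_apply_eq_comp, ← inner_self_eq_norm_sq (𝕜 := ℂ)]
  congr 2
  exact h0.isSelfAdjoint.isSymmetric _ _

/-- The resolution of the identity `∑ b_α T_α Δ² T_α^* = I` for pure tuples. -/
theorem tsum_b_mul_norm_Delta_sq (hm : 1 ≤ m) (hT : T ∈ domain f m H) (h : H)
    (hp : Tendsto (fun j => (formMap f T)^[j] normForm h) atTop (𝓝 0)) :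
    ∑' α, ENNReal.ofReal (f.b m α * ‖Delta f m T (star (mono T α) h)‖ ^ 2) = normForm h := by
  have hrow := rowBound_of_mem_domain hm hT
  have h1 : ∀ α, ENNReal.ofReal (f.b m α * ‖Delta f m T (star (mono T α) h)‖ ^ 2) =
      ENNReal.ofReal (f.wt m α) * opForm (defect f T m) (star (mono T α) h) := by
    intro α
    rw [ENNReal.ofReal_mul (f.b_nonneg m α), norm_Delta_sq hT, f.b_eq_wt hm]
  simp only [h1]
  rw [tsum_wt_mul_form]
  have h2 : defect f T 0 = 1 := rfl
  -- Here `d k j` is the form of Φ^j(D_k) at `h`, with D_k the `k`-th defect. The difference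
  -- equation is D_k = D_{k+1} + Φ(D_k), and `d 0` tends to zero by `hp`.
  have := tsum_multichoose_mul (m := m)
    (fun k j => (formMap f T)^[j] (opForm (defect f T k)) h) ?_ ?_ le_rfl
  · rw [this, h2, opForm_one]
    rfl
  · intro k hk j
    have hD := defect_nonneg hT hk.le
    have hD' := defect_nonneg hT (k := k + 1) hk
    have h3 : defect f T k = defect f T (k + 1) + Phi f T (defect f T k) := by
      rw [defect, defect, Function.iterate_succ_apply', sub_add_cancel]
    have h4 : opForm (defect f T k) =
        opForm (defect f T (k + 1)) + formMap f T (opForm (defect f T k)) := by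
      rw [hrow.formMap_opForm zero_le_one hD, ← opForm_add hD' (hrow.phi_nonneg zero_le_one hD),
        ← h3]
    change _ + (formMap f T)^[j + 1] (opForm (defect f T k)) h = _
    conv_rhs => rw [h4, iterate_formMap_add]
    rfl
  · simpa only [h2, opForm_one] using hp

/-- Convergence of `∑ b_α T_α T_α^*` for strict row contractions. -/
theorem RowBound.summable_b_mul_norm_sq (hm : 1 ≤ m) (hc : 0 ≤ c) (hc1 : c < 1)
    (hT : RowBound f T c) (h : H) : Summable fun α => f.b m α * ‖star (mono T α) h‖ ^ 2 := by
  have hsum : Summable fun j : ℕ => ((m.multichoose j : ℝ) * (c ^ 2) ^ j) * ‖h‖ ^ 2 := by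
    refine Summable.mul_right _ ?_
    have hlt : ‖c ^ 2‖ < 1 := by
      rw [Real.norm_of_nonneg (sq_nonneg c)]
      exact pow_lt_one₀ hc hc1 two_ne_zero
    -- The negative binomial series: `m.multichoose j` equals `(j + (m - 1)).choose (m - 1)`.
    refine (summable_choose_mul_geometric_of_norm_lt_one (m - 1) hlt).congr fun j => ?_
    rw [Nat.multichoose_eq, Nat.choose_symm_of_eq_add (b := m - 1) (a := j) (by omega),
      show m + j - 1 = j + (m - 1) by omega]
  refine summable_of_tsum_ofReal_le (P := ∑' j : ℕ, ((m.multichoose j : ℝ) * (c ^ 2) ^ j) *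
    ‖h‖ ^ 2) (fun α => mul_nonneg (f.b_nonneg m α) (sq_nonneg _))
    (tsum_nonneg fun _ => by positivity) ?_
  have h1 : ∀ α, ENNReal.ofReal (f.b m α * ‖star (mono T α) h‖ ^ 2) =
      ENNReal.ofReal (f.wt m α) * normForm (star (mono T α) h) := by
    intro α
    rw [ENNReal.ofReal_mul (f.b_nonneg m α), normForm, f.b_eq_wt hm]
  simp only [h1]
  rw [tsum_wt_mul_form, ENNReal.ofReal_tsum_of_nonneg (fun _ => by positivity) hsum]
  refine ENNReal.tsum_le_tsum fun j => ?_
  rw [mul_assoc, ENNReal.ofReal_mul (Nat.cast_nonneg _), ENNReal.ofReal_natCast,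
    ENNReal.ofReal_mul (by positivity)]
  exact mul_le_mul_right (hT.iterate_formMap_normForm_le j h) _

end RowBound

/-! ### The operator `∑ a_{α~} Λ_α ⊗ T_{α~}^*` -/

section Resolvent

theorem isUnit_one_sub_clm {K : Type*} [NormedAddCommGroup K] [NormedSpace ℂ K] [CompleteSpace K]
    {R : K →L[ℂ] K} (hR : ‖R‖ < 1) : IsUnit (1 - R) :=
  isUnit_one_sub_of_norm_lt_one hR

theorem star_one_sub_clm {K : Type*} [NormedAddCommGroup K] [InnerProductSpace ℂ K]
    [CompleteSpace K] (R : K →L[ℂ] K) : star (1 - R) = 1 - star R := by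
  rw [star_sub, star_one]

variable {n : ℕ} {H : Type*} [NormedAddCommGroup H] [InnerProductSpace ℂ H] [CompleteSpace H]
  {f : PosRegular n} {m : ℕ} {T : Fin n → H →L[ℂ] H} {c : ℝ}

theorem tsum_reverse (F : List (Fin n) → ℝ≥0∞) : ∑' α : List (Fin n), F α.reverse = ∑' α, F α :=
  (List.reverse_involutive (α := Fin n)).toPerm.tsum_eq F

theorem coord_one_tensorOp_star (B : H →L[ℂ] H) (δ : List (Fin n)) (v : HTensor (Fock n) H) :
    coord H δ (tensorOp 1 (star B) v) = star B (coord H δ v) := by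
  have h := coord_tensorOp_star (1 : Fock n →L[ℂ] Fock n) B (γ := δ) (δ := δ) (c := 1)
    (by simp) v
  rwa [star_one, Complex.ofReal_one, one_smul] at h

theorem coord_star_tensorOp_one (A : Fock n →L[ℂ] Fock n) {γ δ : List (Fin n)}
    {a : ℝ} (h : A (e γ) = (a : ℂ) • e δ) (v : HTensor (Fock n) H) :
    coord H γ (tensorOp (star A) 1 v) = (a : ℂ) • coord H δ v := by
  have h := coord_tensorOp_star A (1 : H →L[ℂ] H) h v
  rwa [star_one, one_apply_eq_self] at h

theorem RowBound.tsum_ampliation_le (hT : RowBound f T c) (v : HTensor (Fock n) H) :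
    ∑' α : List (Fin n), ENNReal.ofReal
      ((√(f.coeff α.reverse) * ‖tensorOp 1 (star (mono T α.reverse)) v‖) ^ 2) ≤
      ENNReal.ofReal ((c * ‖v‖) ^ 2) := by
  rw [tsum_reverse (fun α => ENNReal.ofReal
    ((√(f.coeff α) * ‖tensorOp 1 (star (mono T α)) v‖) ^ 2))]
  calc _ = ∑' α, ∑' δ, ENNReal.ofReal
        ((√(f.coeff α) * ‖star (mono T α) (coord H δ v)‖) ^ 2) := by
        refine tsum_congr fun α => ?_
        rw [mul_pow, ENNReal.ofReal_mul (sq_nonneg _), ← tsum_norm_coord_sq,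
          ← ENNReal.tsum_mul_left]
        refine tsum_congr fun δ => ?_
        rw [coord_one_tensorOp_star, mul_pow, ENNReal.ofReal_mul (sq_nonneg _)]
    _ = ∑' δ, ∑' α, ENNReal.ofReal
        ((√(f.coeff α) * ‖star (mono T α) (coord H δ v)‖) ^ 2) := ENNReal.tsum_comm
    _ ≤ ∑' δ, ENNReal.ofReal ((c * ‖coord H δ v‖) ^ 2) :=
        ENNReal.tsum_le_tsum fun δ => hT.tsum_le _
    _ = _ := by
        simp only [mul_pow, ENNReal.ofReal_mul (sq_nonneg c)]
        rw [ENNReal.tsum_mul_left, tsum_norm_coord_sq]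

/-- In coordinates the left side weights the word `δ` by the sum of `b_γ a_β / b_δ` over all cuts `δ
= γβ`, and that sum is at most one by `sum_b_mul_coeff_le`. -/
theorem tsum_star_mono_Lam_le (hm : 1 ≤ m) (v : HTensor (Fock n) H) :
    ∑' α : List (Fin n), ENNReal.ofReal
      ((√(f.coeff α.reverse) * ‖tensorOp (star (mono (Lam f m) α)) 1 v‖) ^ 2) ≤
      ENNReal.ofReal (‖v‖ ^ 2) := by
  have h1 : ∀ α γ : List (Fin n), ENNReal.ofReal (f.coeff α.reverse) *
      ENNReal.ofReal (‖coord H γ (tensorOp (star (mono (Lam f m) α)) 1 v)‖ ^ 2) =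
      ENNReal.ofReal (f.b m γ * f.coeff α.reverse / f.b m (γ ++ α.reverse) *
        ‖coord H (γ ++ α.reverse) v‖ ^ 2) := by
    intro α γ
    rw [coord_star_tensorOp_one _ (mono_Lam_e f m α γ), norm_smul, Complex.norm_real,
      Real.norm_of_nonneg (Real.sqrt_nonneg _), mul_pow,
      Real.sq_sqrt (div_nonneg (f.b_nonneg _ _) (f.b_nonneg _ _)),
      ← ENNReal.ofReal_mul (f.coeff_nonneg _)]
    congr 1
    ring
  calc _ = ∑' α : List (Fin n), ∑' γ, ENNReal.ofReal
        (f.b m γ * f.coeff α.reverse / f.b m (γ ++ α.reverse) *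
          ‖coord H (γ ++ α.reverse) v‖ ^ 2) := by
        refine tsum_congr fun α => ?_
        rw [mul_pow, Real.sq_sqrt (f.coeff_nonneg _), ENNReal.ofReal_mul (f.coeff_nonneg _),
          ← tsum_norm_coord_sq, ← ENNReal.tsum_mul_left]
        exact tsum_congr (h1 α)
    _ = ∑' γ, ∑' β, ENNReal.ofReal
        (f.b m γ * f.coeff β / f.b m (γ ++ β) * ‖coord H (γ ++ β) v‖ ^ 2) := by
        rw [tsum_reverse (fun β => ∑' γ, ENNReal.ofReal
          (f.b m γ * f.coeff β / f.b m (γ ++ β) * ‖coord H (γ ++ β) v‖ ^ 2)), ENNReal.tsum_comm]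
    _ = ∑' δ : List (Fin n), ∑ i ∈ Finset.range (δ.length + 1), ENNReal.ofReal
        (f.b m (δ.take i) * f.coeff (δ.drop i) / f.b m δ * ‖coord H δ v‖ ^ 2) := by
        rw [tsum_words_prod]
        simp only [List.take_append_drop]
    _ ≤ ∑' δ, ENNReal.ofReal (‖coord H δ v‖ ^ 2) := by
        refine ENNReal.tsum_le_tsum fun δ => ?_
        rw [← ENNReal.ofReal_sum_of_nonneg fun i _ => mul_nonneg (div_nonneg
          (mul_nonneg (f.b_nonneg _ _) (f.coeff_nonneg _)) (f.b_nonneg _ _)) (sq_nonneg _),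
          ← Finset.sum_mul, ← Finset.sum_div]
        refine ENNReal.ofReal_le_ofReal (mul_le_of_le_one_left (sq_nonneg _) ?_)
        rw [div_le_one (f.b_pos m δ)]
        exact f.sum_b_mul_coeff_le hm δ
    _ = _ := tsum_norm_coord_sq v

theorem inner_resTerm (α : List (Fin n)) (x y : HTensor (Fock n) H) :
    inner ℂ y (resTerm f m T α x) = (f.coeff α.reverse : ℂ) *
      inner ℂ (tensorOp (star (mono (Lam f m) α)) (mono T α.reverse) y) x := by
  rw [resTerm, smul_apply, inner_smul_right]
  congr 1
  have h := star_tensorOp (mono (Lam f m) α) (star (mono T α.reverse))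
  rw [star_star] at h
  rw [← h, ContinuousLinearMap.star_eq_adjoint (tensorOp _ _),
    ContinuousLinearMap.adjoint_inner_left]

theorem inner_resTermStar (α : List (Fin n)) (x y : HTensor (Fock n) H) :
    inner ℂ y (resTermStar f m T α x) = star (inner ℂ x (resTerm f m T α y)) := by
  rw [inner_resTerm, resTermStar, smul_apply, inner_smul_right, star_mul', RCLike.star_def,
    Complex.conj_ofReal, inner_conj_symm]

/-- Writing each tensor as `(Λ_α ⊗ 1)(1 ⊗ T_{α~}^*)` exhibits the series as a row of norm at most
`1` times a column of norm at most `c`; Cauchy–Schwarz does the rest. -/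
theorem RowBound.exists_resolvent (hm : 1 ≤ m) (hc : 0 ≤ c) (hT : RowBound f T c) :
    ∃ R : HTensor (Fock n) H →L[ℂ] HTensor (Fock n) H, ‖R‖ ≤ c ∧
      ∀ x y, HasSum (fun α => inner ℂ y (resTerm f m T α x)) (inner ℂ y (R x)) := by
  have hu : ∀ (x y : HTensor (Fock n) H) (α : List (Fin n)),
      ‖inner ℂ y (resTerm f m T α x)‖ ≤
        √(f.coeff α.reverse) * ‖tensorOp 1 (star (mono T α.reverse)) x‖ *
        (√(f.coeff α.reverse) * ‖tensorOp (star (mono (Lam f m) α)) 1 y‖) := by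
    intro x y α
    have h1 : tensorOp (star (mono (Lam f m) α)) (mono T α.reverse) =
        star (tensorOp 1 (star (mono T α.reverse))) * tensorOp (star (mono (Lam f m) α)) 1 := by
      rw [star_tensorOp, star_star, ← tensorOp_mul, star_one, one_mul, mul_one]
    rw [inner_resTerm, h1, mul_apply_eq_comp, ContinuousLinearMap.star_eq_adjoint (tensorOp _ _),
      ContinuousLinearMap.adjoint_inner_left, norm_mul, Complex.norm_real,
      Real.norm_of_nonneg (f.coeff_nonneg _)]
    calc _ ≤ f.coeff α.reverse * (‖tensorOp (star (mono (Lam f m) α)) 1 y‖ *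
          ‖tensorOp 1 (star (mono T α.reverse)) x‖) :=
          mul_le_mul_of_nonneg_left (norm_inner_le_norm _ _) (f.coeff_nonneg _)
      _ = √(f.coeff α.reverse) * √(f.coeff α.reverse) *
          (‖tensorOp (star (mono (Lam f m) α)) 1 y‖ *
          ‖tensorOp 1 (star (mono T α.reverse)) x‖) := by
          rw [Real.mul_self_sqrt (f.coeff_nonneg _)]
      _ = _ := by ring
  have hq : ∀ y : HTensor (Fock n) H, ∑' α : List (Fin n), ENNReal.ofReal
      ((√(f.coeff α.reverse) * ‖tensorOp (star (mono (Lam f m) α)) 1 y‖) ^ 2) ≤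
      ENNReal.ofReal ((1 * ‖y‖) ^ 2) := by
    intro y
    rw [one_mul]
    exact tsum_star_mono_Lam_le hm y
  have h := exists_hasSum_inner_of_cauchySchwarz hc zero_le_one hu hT.tsum_ampliation_le hq
  rwa [mul_one] at h

theorem hasSum_resTermStar {R : HTensor (Fock n) H →L[ℂ] HTensor (Fock n) H}
    (hR : ∀ x y, HasSum (fun α => inner ℂ y (resTerm f m T α x)) (inner ℂ y (R x)))
    (x y : HTensor (Fock n) H) :
    HasSum (fun α => inner ℂ y (resTermStar f m T α x)) (inner ℂ y (star R x)) := by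
  simp only [inner_resTermStar]
  have h := (hR y x).star
  rwa [ContinuousLinearMap.star_eq_adjoint, ContinuousLinearMap.adjoint_inner_right,
    ← inner_conj_symm (R y) x, ← RCLike.star_def]

theorem RowBound.berezinDefined (hm : 1 ≤ m) (hc : 0 ≤ c) (hc1 : c < 1)
    (hT : RowBound f T c) (hd : T ∈ domain f m H) : BerezinDefined f m T := by
  obtain ⟨R, hR, hs⟩ := hT.exists_resolvent hm hc
  have hs' := hasSum_resTermStar hs
  have hu : IsUnit (1 - R) := isUnit_one_sub_clm (hR.trans_lt hc1)
  refine ⟨hd, hT.exists_jointSpectralRadius hc hc1, wotSummable_of_hasSum hs,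
    wotSummable_of_hasSum hs', ?_, ?_⟩
  · rwa [wotSum_eq hs]
  · rw [wotSum_eq hs', ← star_one_sub_clm]
    exact hu.star

theorem inner_tensorVec_resTerm_reverse (α δ : List (Fin n)) (y : H) (w : HTensor (Fock n) H) :
    inner ℂ (tensorVec H (e δ) y) (resTerm f m T α.reverse w) =
      if α <:+ δ then inner ℂ y
        (((f.coeff α * √(f.b m (δ.take (δ.length - α.length)) / f.b m δ) : ℝ) : ℂ) •
        star (mono T α) (coord H (δ.take (δ.length - α.length)) w)) else 0 := by
  rw [inner_resTerm, tensorOp_tensorVec, star_mono_Lam_e, List.reverse_reverse,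
    List.length_reverse]
  split_ifs with h
  · rw [tensorVec_smul, smul_apply, inner_smul_left, Complex.conj_ofReal, inner_smul_right,
      ContinuousLinearMap.star_eq_adjoint, ContinuousLinearMap.adjoint_inner_right,
      inner_coord_right, Complex.ofReal_mul, mul_assoc]
  · rw [tensorVec_zero, zero_apply, inner_zero_left, mul_zero]

/-- The series is finite: the suffixes of `δ` are the words `δ.drop i`, and distinct cuts give
suffixes of distinct length. -/
theorem eq_sum_drop_of_hasSum {F : List (Fin n) → ℂ} {s : ℂ} {δ : List (Fin n)}
    (h : HasSum F s) (h0 : ∀ α, ¬ α.reverse <:+ δ → F α = 0) :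
    s = ∑ i ∈ Finset.range (δ.length + 1), F (δ.drop i).reverse := by
  have h2 : HasSum (fun α : List (Fin n) => F α.reverse) s :=
    (List.reverse_involutive (α := Fin n)).toPerm.hasSum_iff.2 h
  have h3 : HasSum (fun α : List (Fin n) => F α.reverse)
      (∑ α ∈ (Finset.range (δ.length + 1)).image δ.drop, F α.reverse) := by
    refine hasSum_sum_of_ne_finset_zero fun α hα => h0 _ fun hs => ?_
    rw [List.reverse_reverse] at hs
    refine hα (Finset.mem_image.2 ⟨δ.length - α.length, by simp, ?_⟩)
    exact (List.suffix_iff_eq_drop.1 hs).symm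
  rw [h2.unique h3, Finset.sum_image]
  intro i hi j hj hij
  have := congrArg List.length hij
  simp at hi hj this
  omega

/-- A suffix `β` of `δ` contributes exactly when `δ = γβ`, so in coordinates R is a convolution with
the coefficients of f, distorted by the weights `√(b_γ / b_δ)`. -/
theorem coord_resolvent {R : HTensor (Fock n) H →L[ℂ] HTensor (Fock n) H}
    (hR : ∀ x y, HasSum (fun α => inner ℂ y (resTerm f m T α x)) (inner ℂ y (R x)))
    (δ : List (Fin n)) (w : HTensor (Fock n) H) :
    coord H δ (R w) = ∑ i ∈ Finset.range (δ.length + 1),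
      ((f.coeff (δ.drop i) * √(f.b m (δ.take i) / f.b m δ) : ℝ) : ℂ) •
        star (mono T (δ.drop i)) (coord H (δ.take i) w) := by
  refine ext_inner_left ℂ fun y => ?_
  rw [inner_coord_right, inner_sum, eq_sum_drop_of_hasSum (hR w (tensorVec H (e δ) y)) (δ := δ)]
  · refine Finset.sum_congr rfl fun i hi => ?_
    have hi' : i ≤ δ.length := by simpa [Nat.lt_succ_iff] using hi
    rw [inner_tensorVec_resTerm_reverse, if_pos (List.drop_suffix i δ), List.length_drop,
      Nat.sub_sub_self hi']
  · intro α hα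
    rw [← List.reverse_reverse α, inner_tensorVec_resTerm_reverse, if_neg hα]

/-- Let `v k` have coordinates `(wt k α / √b_α) T_α^* x`. The recursion `wt_succ` gives `(1 - R) (v
(k + 1)) = v k`, and `v 0 = 1 ⊗ x`, so the right side is `v m`; there `wt m = b` and `b / √b = √b`.
-/
theorem RowBound.inverse_pow_tensorVec (hm : 1 ≤ m) (hc : 0 ≤ c) (hc1 : c < 1)
    (hT : RowBound f T c) {R : HTensor (Fock n) H →L[ℂ] HTensor (Fock n) H} (hRc : ‖R‖ ≤ c)
    (hR : ∀ x y, HasSum (fun α => inner ℂ y (resTerm f m T α x)) (inner ℂ y (R x))) (x : H) :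
    HasSum (fun α => tensorVec H (e α) ((√(f.b m α) : ℂ) • star (mono T α) x))
      ((Ring.inverse (1 - R) ^ m) (tensorVec H (e []) x)) := by
  have hsq : ∀ α, 0 < √(f.b m α) := fun α => Real.sqrt_pos.2 (f.b_pos m α)
  let u : ℕ → List (Fin n) → H := fun k α =>
    ((f.wt k α / √(f.b m α) : ℝ) : ℂ) • star (mono T α) x
  -- Since `wt k ≤ wt m = b`, the squared coordinates are dominated by `b_α ‖T_α^* x‖²`.
  have hu : ∀ k ≤ m, Summable fun α => tensorVec H (e α) (u k α) := by
    intro k hk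
    refine summable_tensorVec (Summable.of_nonneg_of_le (fun _ => sq_nonneg _) (fun α => ?_)
      (hT.summable_b_mul_norm_sq hm hc hc1 x))
    rw [norm_smul, mul_pow, Complex.norm_real, Real.norm_of_nonneg
      (div_nonneg (f.wt_nonneg k α) (Real.sqrt_nonneg _)), div_pow, Real.sq_sqrt (f.b_nonneg m α)]
    refine mul_le_mul_of_nonneg_right ?_ (sq_nonneg _)
    rw [div_le_iff₀ (f.b_pos m α), ← sq]
    refine pow_le_pow_left₀ (f.wt_nonneg k α) ?_ 2
    rw [f.b_eq_wt hm]
    exact f.wt_mono hk α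
  let v : ℕ → HTensor (Fock n) H := fun k => ∑' α, tensorVec H (e α) (u k α)
  have hv : ∀ k ≤ m, ∀ α, coord H α (v k) = u k α := fun k hk α =>
    coord_of_hasSum (hu k hk).hasSum α
  have hstep : ∀ k < m, (1 - R) (v (k + 1)) = v k := by
    intro k hk
    refine coord_ext fun δ => ?_
    rw [sub_apply, map_sub, one_apply_eq_self, hv (k + 1) hk, hv k hk.le, coord_resolvent hR]
    have h1 : ∀ i ∈ Finset.range (δ.length + 1),
        ((f.coeff (δ.drop i) * √(f.b m (δ.take i) / f.b m δ) : ℝ) : ℂ) •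
          star (mono T (δ.drop i)) (coord H (δ.take i) (v (k + 1))) =
        ((f.wt (k + 1) (δ.take i) * f.coeff (δ.drop i) / √(f.b m δ) : ℝ) : ℂ) •
          star (mono T δ) x := by
      intro i _
      rw [hv (k + 1) hk, map_smul, smul_smul, ← Complex.ofReal_mul]
      have h2 : star (mono T (δ.drop i)) (star (mono T (δ.take i)) x) = star (mono T δ) x := by
        conv_rhs => rw [← List.take_append_drop i δ, mono_append, star_mul]
        rfl
      rw [h2, Real.sqrt_div (f.b_nonneg _ _)]
      congr 2
      have := (hsq (δ.take i)).ne'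
      field_simp
    rw [Finset.sum_congr rfl h1, ← Finset.sum_smul, ← sub_smul, ← Complex.ofReal_sum,
      ← Complex.ofReal_sub, ← Finset.sum_div, ← sub_div, f.wt_succ k δ, add_sub_cancel_right]
  have hpow : ∀ k ≤ m, ((1 - R) ^ k) (v k) = v 0 := by
    intro k hk
    induction k with
    | zero => simp
    | succ k ih => rw [pow_succ, mul_apply_eq_comp, hstep k hk, ih (by omega)]
  have hv0 : v 0 = tensorVec H (e []) x := by
    refine coord_ext fun α => ?_
    rw [hv 0 (Nat.zero_le _), coord_tensorVec]
    simp only [u, f.wt_zero]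
    split_ifs with h
    · subst h
      simp [f.b_nil, mono_nil]
    · simp
  have hunit : IsUnit ((1 - R) ^ m) := (isUnit_one_sub_clm (hRc.trans_lt hc1)).pow m
  have hfin : (Ring.inverse (1 - R) ^ m) (tensorVec H (e []) x) = v m := by
    rw [← hv0, ← hpow m le_rfl, ← mul_apply_eq_comp, Ring.inverse_pow,
      Ring.inverse_mul_cancel _ hunit, one_apply_eq_self]
  rw [hfin]
  convert (hu m le_rfl).hasSum using 4 with α
  rw [← f.b_eq_wt hm, ← Complex.ofReal_inj.2 (Real.div_sqrt (x := f.b m α))]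

end Resolvent

/-! ### The Berezin kernel -/

section Kernel

variable {n : ℕ} {H : Type*} [NormedAddCommGroup H] [InnerProductSpace ℂ H] [CompleteSpace H]
  {f : PosRegular n} {m : ℕ} {T : Fin n → H →L[ℂ] H} {c : ℝ}

theorem kernelTerm_apply (α : List (Fin n)) (h : H) : kernelTerm f m T α h =
    tensorVec H (e α) ((√(f.b m α) : ℂ) • Delta f m T (star (mono T α) h)) := by
  rw [kernelTerm, smul_apply, map_smul]
  rfl

theorem norm_kernelTerm_sq (α : List (Fin n)) (h : H) :
    ‖(√(f.b m α) : ℂ) • Delta f m T (star (mono T α) h)‖ ^ 2 =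
      f.b m α * ‖Delta f m T (star (mono T α) h)‖ ^ 2 := by
  rw [norm_smul, mul_pow, Complex.norm_real, Real.norm_of_nonneg (Real.sqrt_nonneg _),
    Real.sq_sqrt (f.b_nonneg m α)]

theorem summable_kernelTerm (hm : 1 ≤ m) (hT : T ∈ domain f m H) (h : H)
    (hp : Tendsto (fun j => (formMap f T)^[j] normForm h) atTop (𝓝 0)) :
    Summable fun α => kernelTerm f m T α h := by
  simp only [kernelTerm_apply]
  refine summable_tensorVec ?_
  simp only [norm_kernelTerm_sq]
  exact summable_of_tsum_ofReal_le (fun α => mul_nonneg (f.b_nonneg m α) (sq_nonneg _))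
    (sq_nonneg ‖h‖) (tsum_b_mul_norm_Delta_sq hm hT h hp).le

/-- Parseval in the coordinates, followed by the resolution of the identity. -/
theorem norm_tsum_kernelTerm (hm : 1 ≤ m) (hT : T ∈ domain f m H) (h : H)
    (hp : Tendsto (fun j => (formMap f T)^[j] normForm h) atTop (𝓝 0)) :
    ‖∑' α, kernelTerm f m T α h‖ = ‖h‖ := by
  have hs := (summable_kernelTerm hm hT h hp).hasSum
  simp only [kernelTerm_apply] at hs ⊢
  have h1 := tsum_norm_coord_sq
    (∑' α, tensorVec H (e α) ((√(f.b m α) : ℂ) • Delta f m T (star (mono T α) h)))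
  simp only [coord_of_hasSum hs, norm_kernelTerm_sq] at h1
  rw [tsum_b_mul_norm_Delta_sq hm hT h hp, normForm,
    ENNReal.ofReal_eq_ofReal_iff (sq_nonneg _) (sq_nonneg _)] at h1
  exact ((sq_eq_sq₀ (norm_nonneg _) (norm_nonneg _)).1 h1).symm

theorem hasSum_kernel (hm : 1 ≤ m) (hT : T ∈ domain f m H)
    (hp : ∀ h : H, Tendsto (fun j => (formMap f T)^[j] normForm h) atTop (𝓝 0)) (h : H) :
    HasSum (fun α => kernelTerm f m T α h) (kernel f m T h) := by
  have hs := fun h => summable_kernelTerm hm hT h (hp h)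
  let S : H →ₗᵢ[ℂ] HTensor (Fock n) H :=
    { toFun := fun h => ∑' α, kernelTerm f m T α h
      map_add' := fun x y => by
        simp only [map_add]
        exact (hs x).tsum_add (hs y)
      map_smul' := fun a x => by
        simp only [map_smul]
        exact (hs x).tsum_const_smul a
      norm_map' := fun x => norm_tsum_kernelTerm hm hT x (hp x) }
  have hS : kernel f m T = S.toContinuousLinearMap :=
    wotSum_eq fun x y => (hs x).hasSum.mapL (innerSL ℂ y)
  rw [hS]
  exact (hs h).hasSum

theorem norm_kernel_apply (hm : 1 ≤ m) (hT : T ∈ domain f m H)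
    (hp : ∀ h : H, Tendsto (fun j => (formMap f T)^[j] normForm h) atTop (𝓝 0)) (h : H) :
    ‖kernel f m T h‖ = ‖h‖ := by
  rw [← (hasSum_kernel hm hT hp h).tsum_eq, norm_tsum_kernelTerm hm hT h (hp h)]

theorem coord_kernel (hm : 1 ≤ m) (hT : T ∈ domain f m H)
    (hp : ∀ h : H, Tendsto (fun j => (formMap f T)^[j] normForm h) atTop (𝓝 0)) (h : H)
    (α : List (Fin n)) :
    coord H α (kernel f m T h) = (√(f.b m α) : ℂ) • Delta f m T (star (mono T α) h) := by
  have hs := hasSum_kernel hm hT hp h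
  simp only [kernelTerm_apply] at hs
  exact coord_of_hasSum hs α

/-- The weight `√(b_γ / b_{iγ})` of W_i cancels the factor `√b_{iγ}` of the kernel and leaves
`√b_γ`. -/
theorem star_W_kernel (hm : 1 ≤ m) (hT : T ∈ domain f m H)
    (hp : ∀ h : H, Tendsto (fun j => (formMap f T)^[j] normForm h) atTop (𝓝 0)) (i : Fin n) :
    tensorOp (star (W f m i)) 1 ∘L kernel f m T = kernel f m T ∘L star (T i) := by
  ext h
  refine coord_ext fun γ => ?_
  rw [ContinuousLinearMap.comp_apply, ContinuousLinearMap.comp_apply,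
    coord_star_tensorOp_one _ (W_e f m i γ), coord_kernel hm hT hp, coord_kernel hm hT hp,
    smul_smul, ← Complex.ofReal_mul, Real.sqrt_div (f.b_nonneg _ _),
    div_mul_cancel₀ _ (Real.sqrt_pos.2 (f.b_pos m _)).ne', mono_cons, star_mul]
  rfl

/-- For strict row contractions the Berezin transform is implemented by the Berezin kernel. -/
theorem RowBound.berezin_eq_extBerezin (hm : 1 ≤ m) (hc : 0 ≤ c) (hc1 : c < 1)
    (hT : RowBound f T c) (hd : T ∈ domain f m H) (g : Fock n →L[ℂ] Fock n) :
    berezin f m T g = extBerezin f m T g := by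
  obtain ⟨R, hRc, hs⟩ := hT.exists_resolvent hm hc
  have hΔ : star (Delta f m T) = Delta f m T :=
    (IsSelfAdjoint.of_nonneg (CFC.sqrt_nonneg (defect f T m))).star_eq
  have hK : kernel f m T = (tensorOp 1 (Delta f m T) * Ring.inverse (1 - R) ^ m) ∘L
      tensorVec H (e []) := by
    ext h
    have h1 := (hT.inverse_pow_tensorVec hm hc hc1 hRc hs h).mapL (tensorOp 1 (Delta f m T))
    refine (hasSum_kernel hm hd (hT.tendsto_iterate_formMap hc hc1) h).unique ?_
    simp only [tensorOp_tensorVec, one_apply_eq_self, map_smul] at h1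
    simpa only [kernelTerm_apply, map_smul] using! h1
  rw [berezin, extBerezin, wotSum_eq hs, wotSum_eq (hasSum_resTermStar hs), hK]
  -- Giving one factor Δ to each resolvent power turns the outer operators into `K^*` and `K`.
  have h2 : tensorOp g (Delta f m T ^ 2) =
      tensorOp 1 (Delta f m T) * tensorOp g 1 * tensorOp 1 (Delta f m T) := by
    rw [← tensorOp_mul, ← tensorOp_mul, one_mul, mul_one, mul_one, sq]
  have h3 : (tensorOp (1 : Fock n →L[ℂ] Fock n) (Delta f m T)).adjoint =
      tensorOp 1 (Delta f m T) := by
    rw [← ContinuousLinearMap.star_eq_adjoint, star_tensorOp, star_one, hΔ]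
  rw [← star_one_sub_clm, Ring.inverse_star, ← star_pow, h2, ContinuousLinearMap.adjoint_comp]
  have h4 : (tensorOp 1 (Delta f m T) * Ring.inverse (1 - R) ^ m).adjoint =
      star (Ring.inverse (1 - R) ^ m) * tensorOp 1 (Delta f m T) := by
    rw [← ContinuousLinearMap.star_eq_adjoint, star_mul, ContinuousLinearMap.star_eq_adjoint
      (tensorOp _ _), h3]
  rw [h4]
  rfl

end Kernel

/-! ### Operator matrices and compressions -/

section OpMatrix

variable {E F : Type*} [NormedAddCommGroup E] [InnerProductSpace ℂ E] [NormedAddCommGroup F]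
  [InnerProductSpace ℂ F] {k : ℕ}

theorem opMatrix_apply (x : Matrix (Fin k) (Fin k) (E →L[ℂ] E))
    (v : PiLp 2 (fun _ : Fin k => E)) (i : Fin k) : opMatrix x v i = ∑ j, x i j (v j) := by
  simp [opMatrix]

/-- The inclusion of the `j`-th summand into `E^{(k)}`. -/
def inclL (E : Type*) [NormedAddCommGroup E] [InnerProductSpace ℂ E] {k : ℕ} (j : Fin k) :
    E →L[ℂ] PiLp 2 (fun _ : Fin k => E) :=
  (PiLp.continuousLinearEquiv 2 ℂ (fun _ : Fin k => E)).symm.toContinuousLinearMap ∘L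
    ContinuousLinearMap.single ℂ (fun _ : Fin k => E) j

/-- The projection of `E^{(k)}` onto the `i`-th summand. -/
def projL (E : Type*) [NormedAddCommGroup E] [InnerProductSpace ℂ E] {k : ℕ} (i : Fin k) :
    PiLp 2 (fun _ : Fin k => E) →L[ℂ] E :=
  PiLp.proj 2 (fun _ : Fin k => E) i

theorem projL_comp_inclL (i j : Fin k) :
    projL E i ∘L inclL E j = if i = j then 1 else 0 := by
  ext x
  split_ifs with h
  · subst h; simp [projL, inclL]
  · simp [projL, inclL, h]

theorem projL_comp_opMatrix_comp_inclL (x : Matrix (Fin k) (Fin k) (E →L[ℂ] E)) (i j : Fin k) :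
    projL E i ∘L opMatrix x ∘L inclL E j = x i j := by
  ext v
  change opMatrix x (inclL E j v) i = x i j v
  rw [opMatrix_apply, Finset.sum_eq_single j]
  · simp [inclL]
  · intro l _ hl
    simp [inclL, hl]
  · simp

theorem norm_sq_opMatrix_apply (x : Matrix (Fin k) (Fin k) (E →L[ℂ] E))
    (v : PiLp 2 (fun _ : Fin k => E)) : ‖opMatrix x v‖ ^ 2 = ∑ i, ‖∑ j, x i j (v j)‖ ^ 2 := by
  rw [PiLp.norm_sq_eq_of_L2]
  exact Finset.sum_congr rfl fun i _ => by rw [opMatrix_apply]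

/-- At a fixed vector the squared norm is a finite sum of terms continuous in the entries, so
entrywise limits preserve the bound. -/
theorem norm_opMatrix_le_of_tendsto {ι : Type*} {l : Filter ι} [l.NeBot]
    {x : ι → Matrix (Fin k) (Fin k) (E →L[ℂ] E)} {y : Matrix (Fin k) (Fin k) (E →L[ℂ] E)}
    {C : ℝ} (hC : 0 ≤ C) (h : ∀ i j, Tendsto (fun a => x a i j) l (𝓝 (y i j)))
    (hx : ∀ᶠ a in l, ‖opMatrix (x a)‖ ≤ C) : ‖opMatrix y‖ ≤ C := by
  refine ContinuousLinearMap.opNorm_le_bound _ hC fun v => ?_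
  rw [← sq_le_sq₀ (norm_nonneg _) (by positivity), norm_sq_opMatrix_apply]
  have hlim : Tendsto (fun a => ∑ i, ‖∑ j, x a i j (v j)‖ ^ 2) l
      (𝓝 (∑ i, ‖∑ j, y i j (v j)‖ ^ 2)) :=
    tendsto_finsetSum _ fun i _ => (tendsto_finsetSum _ fun j _ =>
      ((ContinuousLinearMap.apply ℂ E (v j)).continuous.tendsto _).comp (h i j)).norm.pow 2
  refine le_of_tendsto hlim ?_
  filter_upwards [hx] with a ha
  rw [← norm_sq_opMatrix_apply]
  refine pow_le_pow_left₀ (norm_nonneg _) ?_ 2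
  exact ((opMatrix (x a)).le_opNorm v).trans (mul_le_mul_of_nonneg_right ha (norm_nonneg _))

/-- The coordinate projections `P_i` of the direct sum satisfy `∑ P_i^* P_i = 1`, and this survives
tensoring with `F`. It permits work in `E^{(k)} ⊗ F` without identifying it with `(E ⊗ F)^{(k)}`. -/
theorem sum_norm_sq_tensorMap_projL (u : HTensor (PiLp 2 (fun _ : Fin k => E)) F) :
    ∑ i, ‖tensorMap (projL E i) (1 : F →L[ℂ] F) u‖ ^ 2 = ‖u‖ ^ 2 := by
  have h : ∑ i, (tensorMap (projL E i) (1 : F →L[ℂ] F)).adjoint ∘L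
      tensorMap (projL (k := k) E i) (1 : F →L[ℂ] F) = 1 := by
    refine HTensor.clm_ext fun x y => HTensor.ext_inner fun x' y' => ?_
    rw [sum_apply, sum_inner, one_apply_eq_self, inner_tensorVec,
      PiLp.inner_apply, Finset.sum_mul]
    refine Finset.sum_congr rfl fun i _ => ?_
    rw [ContinuousLinearMap.comp_apply, ContinuousLinearMap.adjoint_inner_left,
      tensorMap_tensorVec, tensorMap_tensorVec, inner_tensorVec]
    rfl
  have h1 : ∀ i, ‖tensorMap (projL E i) (1 : F →L[ℂ] F) u‖ ^ 2 =
      RCLike.re (inner ℂ (((tensorMap (projL E i) (1 : F →L[ℂ] F)).adjoint ∘L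
        tensorMap (projL E i) (1 : F →L[ℂ] F)) u) u) := by
    intro i
    rw [ContinuousLinearMap.comp_apply, ContinuousLinearMap.adjoint_inner_left,
      inner_self_eq_norm_sq (𝕜 := ℂ)]
  rw [Finset.sum_congr rfl fun i _ => h1 i, ← map_sum, ← sum_inner,
    ← sum_apply, h, one_apply_eq_self, inner_self_eq_norm_sq (𝕜 := ℂ)]

end OpMatrix

/-! ### Compressions of representations -/

section Dilation

variable {A G H : Type*} [NormedRing A] [StarRing A] [NormedAlgebra ℂ A]
  [NormedAddCommGroup G] [InnerProductSpace ℂ G] [CompleteSpace G]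
  [NormedAddCommGroup H] [InnerProductSpace ℂ H] [CompleteSpace H]

/-- The compression `g ↦ K^* π(g) K` of a representation `π`. -/
def compression (π : A →ₐ[ℂ] (G →L[ℂ] G)) (K : H →L[ℂ] G) : A →ₗ[ℂ] (H →L[ℂ] H) where
  toFun g := K.adjoint ∘L π g ∘L K
  map_add' g g' := by
    rw [map_add, ContinuousLinearMap.add_comp, ContinuousLinearMap.comp_add]
  map_smul' c g := by
    rw [map_smul, ContinuousLinearMap.smul_comp, ContinuousLinearMap.comp_smul]
    rfl

variable {π : A →ₐ[ℂ] (G →L[ℂ] G)} {K : H →L[ℂ] G}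

theorem compression_apply (g : A) : compression π K g = K.adjoint ∘L π g ∘L K := rfl

theorem norm_adjoint_apply_le (hK : ∀ h, ‖K h‖ = ‖h‖) (v : G) : ‖K.adjoint v‖ ≤ ‖v‖ := by
  have h1 : ‖K‖ ≤ 1 := K.opNorm_le_bound zero_le_one fun h => by rw [hK, one_mul]
  refine (K.adjoint.le_opNorm v).trans (mul_le_of_le_one_left (norm_nonneg _) ?_)
  rwa [LinearIsometryEquiv.norm_map]

theorem norm_compression_le (hπ : ∀ g, ‖π g‖ ≤ ‖g‖) (hK : ∀ h, ‖K h‖ = ‖h‖) (g : A) :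
    ‖compression π K g‖ ≤ ‖g‖ := by
  refine ContinuousLinearMap.opNorm_le_bound _ (norm_nonneg _) fun h => ?_
  refine (norm_adjoint_apply_le hK _).trans ?_
  refine ((π g).le_opNorm (K h)).trans ?_
  rw [hK]
  exact mul_le_mul_of_nonneg_right (hπ g) (norm_nonneg _)

/-- `K` is an isometry which intertwines `T_i^*` with `π(w_i^*)`. -/
structure IsDilation {n : ℕ} (π : A →ₐ[ℂ] (G →L[ℂ] G)) (w : Fin n → A) (T : Fin n → H →L[ℂ] H)
    (K : H →L[ℂ] G) : Prop where
  star_map : ∀ g, π (star g) = star (π g)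
  norm_map : ∀ h, ‖K h‖ = ‖h‖
  intertwine : ∀ i, π (star (w i)) ∘L K = K ∘L star (T i)

variable {n : ℕ} {w : Fin n → A} {T : Fin n → H →L[ℂ] H}

theorem IsDilation.adjoint_comp_self (hK : IsDilation π w T K) : K.adjoint ∘L K = 1 :=
  (ContinuousLinearMap.norm_map_iff_adjoint_comp_self K).1 hK.norm_map

theorem IsDilation.compression_one (hK : IsDilation π w T K) : compression π K 1 = 1 := by
  rw [compression_apply, map_one]
  exact hK.adjoint_comp_self

theorem IsDilation.intertwine_mono (hK : IsDilation π w T K) (α : List (Fin n)) :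
    π (star (mono w α)) ∘L K = K ∘L star (mono T α) := by
  induction α with
  | nil =>
    rw [mono_nil, mono_nil, star_one, star_one, map_one]
    rfl
  | cons i α ih =>
    rw [mono_cons, mono_cons, star_mul, star_mul, map_mul, ContinuousLinearMap.mul_def,
      ContinuousLinearMap.mul_def,
      ContinuousLinearMap.comp_assoc, hK.intertwine, ← ContinuousLinearMap.comp_assoc, ih,
      ContinuousLinearMap.comp_assoc]

theorem IsDilation.adjoint_comp_mono (hK : IsDilation π w T K) (α : List (Fin n)) :
    K.adjoint ∘L π (mono w α) = mono T α ∘L K.adjoint := by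
  have h := congrArg ContinuousLinearMap.adjoint (hK.intertwine_mono α)
  rw [ContinuousLinearMap.adjoint_comp, ContinuousLinearMap.adjoint_comp, hK.star_map,
    ContinuousLinearMap.star_eq_adjoint, ContinuousLinearMap.star_eq_adjoint,
    ContinuousLinearMap.adjoint_adjoint, ContinuousLinearMap.adjoint_adjoint] at h
  exact h

/-- The factor `π(w_β)^*` passes through `K` on the right, `π(w_α)` passes through `K^*` on the
left, and `K^* K = 1` remains. -/
theorem IsDilation.compression_mono (hK : IsDilation π w T K) (α β : List (Fin n)) :
    compression π K (mono w α * star (mono w β)) = mono T α * star (mono T β) := by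
  rw [compression_apply, map_mul, ContinuousLinearMap.mul_def, ContinuousLinearMap.mul_def,
    ContinuousLinearMap.comp_assoc,
    hK.intertwine_mono, ← ContinuousLinearMap.comp_assoc, hK.adjoint_comp_mono,
    ContinuousLinearMap.comp_assoc, ← ContinuousLinearMap.comp_assoc K.adjoint,
    hK.adjoint_comp_self]
  rfl

/-- The elements `g` for which the range of `K` is invariant under `π(g)^*`. -/
def coinvariant (π : A →ₐ[ℂ] (G →L[ℂ] G)) (K : H →L[ℂ] G) (hK : K.adjoint ∘L K = 1) :
    Subalgebra ℂ A where
  carrier := {g | K.adjoint ∘L π g = compression π K g ∘L K.adjoint}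
  mul_mem' {g g'} hg hg' := by
    rw [Set.mem_ofPred_eq] at hg hg' ⊢
    have h : K.adjoint ∘L π (g * g') =
        (compression π K g ∘L compression π K g') ∘L K.adjoint := by
      rw [map_mul, ContinuousLinearMap.mul_def, ← ContinuousLinearMap.comp_assoc, hg,
        ContinuousLinearMap.comp_assoc, hg', ContinuousLinearMap.comp_assoc]
    have h2 : compression π K (g * g') = compression π K g ∘L compression π K g' := by
      rw [compression_apply (g * g'), ← ContinuousLinearMap.comp_assoc, h,
        ContinuousLinearMap.comp_assoc, hK]
      rfl
    rw [h, h2]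
  add_mem' {g g'} hg hg' := by
    rw [Set.mem_ofPred_eq] at hg hg' ⊢
    rw [map_add, map_add, ContinuousLinearMap.comp_add, ContinuousLinearMap.add_comp, hg, hg']
  algebraMap_mem' c := by
    rw [Set.mem_ofPred_eq]
    have h1 : compression π K 1 = 1 := by
      rw [compression_apply, map_one]
      exact hK
    rw [Algebra.algebraMap_eq_smul_one, map_smul, map_smul, map_one, h1,
      ContinuousLinearMap.comp_smul, ContinuousLinearMap.smul_comp]
    rfl

/-- The coinvariant elements form a closed subalgebra containing the `w i`. If `K^* π(g) = φ(g)
K^*`, with φ the compression, then multiplying by `π(g') K` gives the claim for arbitrary `g'`. -/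
theorem IsDilation.compression_mul (hπ : ∀ g, ‖π g‖ ≤ ‖g‖) (hK : IsDilation π w T K) {g g' : A}
    (hg : g ∈ (Algebra.adjoin ℂ (Set.range w)).topologicalClosure) :
    compression π K (g * g') = compression π K g * compression π K g' := by
  have hle : (Algebra.adjoin ℂ (Set.range w)).topologicalClosure ≤
      coinvariant π K hK.adjoint_comp_self := by
    refine Subalgebra.topologicalClosure_minimal (Algebra.adjoin_le ?_) ?_
    · rintro _ ⟨i, rfl⟩
      have h1 := hK.adjoint_comp_mono [i]
      have h2 := hK.compression_mono [i] []
      simp only [mono, List.map_cons, List.map_nil, List.prod_cons, List.prod_nil, mul_one,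
        star_one] at h1 h2
      change K.adjoint ∘L π (w i) = compression π K (w i) ∘L K.adjoint
      rw [h1, h2]
    · have hc : Continuous π := AddMonoidHomClass.continuous_of_bound π 1 fun g => by
        rw [one_mul]
        exact hπ g
      have hc1 : Continuous fun g => K.adjoint ∘L π g := continuous_const.clm_comp hc
      have hc2 : Continuous fun g => compression π K g ∘L K.adjoint :=
        (continuous_const.clm_comp (hc.clm_comp continuous_const)).clm_comp continuous_const
      exact isClosed_eq hc1 hc2
  have hg : K.adjoint ∘L π g = compression π K g ∘L K.adjoint := hle hg
  rw [compression_apply (g * g'), map_mul, ContinuousLinearMap.mul_def,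
    ContinuousLinearMap.mul_def, ContinuousLinearMap.comp_assoc,
    ← ContinuousLinearMap.comp_assoc, hg, ContinuousLinearMap.comp_assoc]
  rfl

end Dilation

/-! ### Complete contractivity, and the Berezin kernel as a dilation -/

section KernelDilation

/-- Compressions by isometries are completely contractive. -/
theorem norm_opMatrix_compression_le {E F H : Type*} [NormedAddCommGroup E]
    [InnerProductSpace ℂ E] [NormedAddCommGroup F] [InnerProductSpace ℂ F] [NormedAddCommGroup H]
    [InnerProductSpace ℂ H] [CompleteSpace H] {k : ℕ} {K : H →L[ℂ] HTensor E F}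
    (hK : ∀ h, ‖K h‖ = ‖h‖)
    (x : Matrix (Fin k) (Fin k) (E →L[ℂ] E)) :
    ‖opMatrix fun i j => compression (ampliation E F) K (x i j)‖ ≤
      ‖opMatrix x‖ := by
  refine ContinuousLinearMap.opNorm_le_bound _ (ContinuousLinearMap.opNorm_nonneg _) fun v => ?_
  -- The vector of `E^{(k)} ⊗ F` with components `K (v j)`; it has the norm of `v`. On it the matrix
  -- acts as the single operator `opMatrix x ⊗ 1`, so the bound for simple ampliations already gives
  -- the matrix bound.
  let w : HTensor (PiLp 2 (fun _ : Fin k => E)) F :=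
    ∑ j, tensorMap (inclL E j) (1 : F →L[ℂ] F) (K (v j))
  let u := tensorMap (opMatrix x) (1 : F →L[ℂ] F) w
  have hw : ∀ i, tensorMap (projL E i) (1 : F →L[ℂ] F) w = K (v i) := by
    intro i
    simp only [w, map_sum]
    rw [Finset.sum_eq_single i]
    · rw [← ContinuousLinearMap.comp_apply, ← tensorMap_comp, projL_comp_inclL, if_pos rfl]
      exact congrArg (fun A : HTensor E F →L[ℂ] HTensor E F => A (K (v i))) tensorMap_one
    · intro j _ hj
      rw [← ContinuousLinearMap.comp_apply, ← tensorMap_comp, projL_comp_inclL,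
        if_neg (Ne.symm hj)]
      exact congrArg (fun A : HTensor E F →L[ℂ] HTensor E F => A (K (v j)))
        (map_zero (ampliation E F))
    · simp
  have hu : ∀ i, tensorMap (projL E i) (1 : F →L[ℂ] F) u =
      ∑ j, tensorOp (x i j) 1 (K (v j)) := by
    intro i
    simp only [u, w, map_sum]
    refine Finset.sum_congr rfl fun j _ => ?_
    rw [← projL_comp_opMatrix_comp_inclL x i j]
    exact congrArg (fun A : HTensor E F →L[ℂ] HTensor E F => A (K (v j)))
      ((tensorMap_comp (projL E i) (opMatrix x ∘L inclL E j) (1 : F →L[ℂ] F) 1).trans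
        (congrArg (fun A => tensorMap (projL E i) (1 : F →L[ℂ] F) ∘L A)
          (tensorMap_comp (opMatrix x) (inclL E j) (1 : F →L[ℂ] F) 1))).symm
  have hwn : ‖w‖ ^ 2 = ‖v‖ ^ 2 := by
    rw [← sum_norm_sq_tensorMap_projL, PiLp.norm_sq_eq_of_L2]
    exact Finset.sum_congr rfl fun i _ => by rw [hw, hK]
  have hun : ‖u‖ ≤ ‖opMatrix x‖ * ‖w‖ := by
    refine (ContinuousLinearMap.le_opNorm _ _).trans
      (mul_le_mul_of_nonneg_right ?_ (norm_nonneg _))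
    exact norm_ampliation_le (opMatrix x)
  have hv : ‖opMatrix (fun i j => compression (ampliation E F) K (x i j)) v‖ ^ 2 ≤ ‖u‖ ^ 2 := by
    rw [← sum_norm_sq_tensorMap_projL, PiLp.norm_sq_eq_of_L2]
    refine Finset.sum_le_sum fun i _ => pow_le_pow_left₀ (norm_nonneg _) ?_ 2
    have : opMatrix (fun i j => compression (ampliation E F) K (x i j)) v i =
        K.adjoint (∑ j, tensorOp (x i j) 1 (K (v j))) := by
      refine (opMatrix_apply _ v i).trans ?_
      rw [map_sum]
      rfl
    rw [this, hu]
    exact norm_adjoint_apply_le hK _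
  have h1 := (sq_eq_sq₀ (norm_nonneg _) (norm_nonneg _)).1 hwn
  have h2 := (sq_le_sq₀ (norm_nonneg _) (norm_nonneg _)).1 hv
  rw [← h1]
  exact h2.trans hun


variable {n : ℕ} {H : Type*} [NormedAddCommGroup H] [InnerProductSpace ℂ H] [CompleteSpace H]
  {f : PosRegular n} {m : ℕ} {T : Fin n → H →L[ℂ] H}

theorem isDilation_kernel (hm : 1 ≤ m) (hT : T ∈ domain f m H)
    (hp : ∀ h : H, Tendsto (fun j => (formMap f T)^[j] normForm h) atTop (𝓝 0)) :
    IsDilation (ampliation (Fock n) H) (W f m) T (kernel f m T) where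
  star_map g := by
    rw [ampliation_apply, ampliation_apply, star_tensorOp, star_one]
  norm_map := norm_kernel_apply hm hT hp
  intertwine := star_W_kernel hm hT hp

theorem extBerezin_eq_compression (g : Fock n →L[ℂ] Fock n) :
    extBerezin f m T g = compression (ampliation (Fock n) H) (kernel f m T) g := rfl

end KernelDilation

/-! ### Limits of bounded families of linear maps -/

section Limits

variable {ι A B : Type*} [NormedAddCommGroup A] [NormedSpace ℂ A] [NormedAddCommGroup B]
  [NormedSpace ℂ B] {l : Filter ι}

theorem tendsto_zero_of_mem_closure_span {u : ι → A →ₗ[ℂ] B} {C : ℝ} (hC : 0 < C)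
    (hb : ∀ᶠ i in l, ∀ g, ‖u i g‖ ≤ C * ‖g‖) {s : Set A}
    (hs : ∀ g ∈ s, Tendsto (fun i => u i g) l (𝓝 0)) {g : A}
    (hg : g ∈ (Submodule.span ℂ s).topologicalClosure) :
    Tendsto (fun i => u i g) l (𝓝 0) := by
  have hspan : ∀ g ∈ Submodule.span ℂ s, Tendsto (fun i => u i g) l (𝓝 0) := by
    intro g hg
    induction hg using Submodule.span_induction with
    | mem g hg => exact hs g hg
    | zero => simpa using tendsto_const_nhds
    | add g g' _ _ h h' => simpa using h.add h'
    | smul c g _ h => simpa using h.const_smul c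
  rw [Metric.tendsto_nhds]
  intro ε hε
  obtain ⟨g', hg', hd⟩ := Metric.mem_closure_iff.1 hg (ε / (2 * C)) (by positivity)
  filter_upwards [hb, Metric.tendsto_nhds.1 (hspan g' hg') (ε / 2) (by positivity)]
    with i hi hi'
  rw [dist_zero_right] at hi' ⊢
  have h1 : u i g = u i (g - g') + u i g' := by rw [← map_add, sub_add_cancel]
  rw [dist_eq_norm] at hd
  calc ‖u i g‖ ≤ ‖u i (g - g')‖ + ‖u i g'‖ := by rw [h1]; exact norm_add_le _ _
    _ < C * (ε / (2 * C)) + ε / 2 :=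
        add_lt_add_of_le_of_lt ((hi _).trans (mul_le_mul_of_nonneg_left hd.le hC.le)) hi'
    _ = ε := by field_simp; ring

/-- The differences `u p.1 - u p.2` along `l ×ˢ l` are eventually bounded by `2` and tend to zero on
`s`, hence on its closed span. So the values are Cauchy, with no candidate limit needed in advance.
-/
theorem exists_tendsto_of_mem_closure_span [CompleteSpace B] [l.NeBot] {u : ι → A →ₗ[ℂ] B}
    (hb : ∀ᶠ i in l, ∀ g, ‖u i g‖ ≤ ‖g‖) {s : Set A}
    (hs : ∀ g ∈ s, ∃ b, Tendsto (fun i => u i g) l (𝓝 b)) {g : A}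
    (hg : g ∈ (Submodule.span ℂ s).topologicalClosure) :
    ∃ b, Tendsto (fun i => u i g) l (𝓝 b) := by
  have h : Tendsto (fun p : ι × ι => (u p.1 - u p.2) g) (l ×ˢ l) (𝓝 0) := by
    refine tendsto_zero_of_mem_closure_span (C := 2) two_pos ?_ (fun g' hg' => ?_) hg
    · filter_upwards [hb.prod_mk hb] with p hp g'
      rw [LinearMap.sub_apply]
      linarith [norm_sub_le (u p.1 g') (u p.2 g'), hp.1 g', hp.2 g']
    · obtain ⟨b, hb'⟩ := hs g' hg'
      have := (hb'.comp tendsto_fst).sub (hb'.comp (tendsto_snd (f := l)))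
      rw [sub_self] at this
      exact this
  have hcau : Cauchy (map (fun i => u i g) l) := by
    rw [cauchy_map_iff, Metric.uniformity_eq_comap_nhds_zero, tendsto_comap_iff]
    refine ⟨inferInstance, ?_⟩
    have h1 := h.norm
    rw [norm_zero] at h1
    refine h1.congr fun p => ?_
    rw [LinearMap.sub_apply, ← dist_eq_norm]
    rfl
  exact CompleteSpace.complete hcau

end Limits

/-! ### Passage to the limit as r tends to 1 -/

section Main

variable {n : ℕ} {H : Type*} [NormedAddCommGroup H] [InnerProductSpace ℂ H] [CompleteSpace H]
  {f : PosRegular n} {m : ℕ} {T : Fin n → H →L[ℂ] H}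

theorem HasRadialProperty.eventually_rowBound (hm : 1 ≤ m) (hT : HasRadialProperty f m T) :
    ∀ᶠ r : ℝ in 𝓝[<] 1, 0 ≤ r ∧ r < 1 ∧ RowBound f (scale r T) r ∧ scale r T ∈ domain f m H := by
  obtain ⟨hd, δ, hδ0, hδ1, hr⟩ := hT
  filter_upwards [Ioo_mem_nhdsLT hδ1] with r hr'
  exact ⟨(hδ0.trans hr'.1).le, hr'.2,
    (rowBound_of_mem_domain hm hd).scale (hδ0.trans hr'.1).le hr'.2.le, hr r hr'.1 hr'.2⟩

theorem HasRadialProperty.eventually_berezinDefined (hm : 1 ≤ m)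
    (hT : HasRadialProperty f m T) : ∀ᶠ r : ℝ in 𝓝[<] 1, BerezinDefined f m (scale r T) := by
  filter_upwards [hT.eventually_rowBound hm] with r ⟨h0, h1, hr, hd⟩
  exact hr.berezinDefined hm h0 h1 hd

theorem HasRadialProperty.eventually_isDilation (hm : 1 ≤ m) (hT : HasRadialProperty f m T) :
    ∀ᶠ r : ℝ in 𝓝[<] 1, IsDilation (ampliation (Fock n) H) (W f m) (scale r T)
      (kernel f m (scale r T)) := by
  filter_upwards [hT.eventually_rowBound hm] with r ⟨h0, h1, hr, hd⟩
  exact isDilation_kernel hm hd (hr.tendsto_iterate_formMap h0 h1)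

theorem HasRadialProperty.eventually_berezin_eq (hm : 1 ≤ m) (hT : HasRadialProperty f m T)
    (g : Fock n →L[ℂ] Fock n) : (fun r : ℝ => compression (ampliation (Fock n) H)
      (kernel f m (scale r T)) g) =ᶠ[𝓝[<] 1] fun r => berezin f m (scale r T) g := by
  filter_upwards [hT.eventually_rowBound hm] with r ⟨h0, h1, hr, hd⟩
  exact (hr.berezin_eq_extBerezin hm h0 h1 hd g).symm

/-- Near `1` the value is exactly r^(|α|+|β|) T_α T_β^*, by the dilation property of the kernel of
rT. -/
theorem HasRadialProperty.tendsto_compression_mono (hm : 1 ≤ m) (hT : HasRadialProperty f m T)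
    (α β : List (Fin n)) :
    Tendsto (fun r : ℝ => compression (ampliation (Fock n) H) (kernel f m (scale r T))
      (mono (W f m) α * star (mono (W f m) β))) (𝓝[<] 1)
      (𝓝 (mono T α * star (mono T β))) := by
  have hc : Continuous fun r : ℝ => ((r ^ α.length * r ^ β.length : ℝ) : ℂ) •
      (mono T α * star (mono T β)) := by fun_prop
  have h1 := (hc.tendsto 1).mono_left (nhdsWithin_le_nhds (s := Set.Iio 1))
  simp only [one_pow, mul_one, Complex.ofReal_one, one_smul] at h1
  refine h1.congr' ?_
  filter_upwards [hT.eventually_isDilation hm] with r hr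
  rw [hr.compression_mono, mono_scale, mono_scale, star_smul, smul_mul_smul_comm,
    RCLike.star_def, Complex.conj_ofReal, ← Complex.ofReal_mul]

theorem HasRadialProperty.eventually_norm_compression_le (hm : 1 ≤ m)
    (hT : HasRadialProperty f m T) : ∀ᶠ r : ℝ in 𝓝[<] 1, ∀ g : Fock n →L[ℂ] Fock n,
      ‖compression (ampliation (Fock n) H) (kernel f m (scale r T)) g‖ ≤ ‖g‖ := by
  filter_upwards [hT.eventually_isDilation hm] with r hr g
  exact norm_compression_le norm_ampliation_le hr.norm_map g

theorem HasRadialProperty.exists_tendsto_compression (hm : 1 ≤ m)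
    (hT : HasRadialProperty f m T) (g : opSystem f m) :
    ∃ L : H →L[ℂ] H, Tendsto (fun r : ℝ =>
      compression (ampliation (Fock n) H) (kernel f m (scale r T)) g) (𝓝[<] 1) (𝓝 L) := by
  refine exists_tendsto_of_mem_closure_span (A := Fock n →L[ℂ] Fock n) (B := H →L[ℂ] H)
    (u := fun r : ℝ => compression (ampliation (Fock n) H) (kernel f m (scale r T)))
    (s := Set.range fun p : List (Fin n) × List (Fin n) =>
      mono (W f m) p.1 * star (mono (W f m) p.2)) (g := (g : Fock n →L[ℂ] Fock n))
    (hT.eventually_norm_compression_le hm) ?_ g.2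
  rintro _ ⟨⟨α, β⟩, rfl⟩
  exact ⟨_, hT.tendsto_compression_mono hm α β⟩

theorem HasRadialProperty.exists_limit (hm : 1 ≤ m) (hT : HasRadialProperty f m T) :
    ∃ Ψ : opSystem f m →ₗ[ℂ] (H →L[ℂ] H), ∀ g : opSystem f m,
      Tendsto (fun r : ℝ => compression (ampliation (Fock n) H) (kernel f m (scale r T))
        (g : Fock n →L[ℂ] Fock n)) (𝓝[<] 1) (𝓝 (Ψ g)) := by
  choose L hL using hT.exists_tendsto_compression hm
  refine ⟨{ toFun := L, map_add' := fun g g' => ?_, map_smul' := fun c g => ?_ }, hL⟩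
  · refine tendsto_nhds_unique (hL (g + g')) (((hL g).add (hL g')).congr fun r => ?_)
    rw [Submodule.coe_add, map_add]
  · refine tendsto_nhds_unique (hL (c • g)) (((hL g).const_smul c).congr fun r => ?_)
    rw [Submodule.coe_smul, map_smul]

theorem HasRadialProperty.completelyContractive_limit (hm : 1 ≤ m)
    (hT : HasRadialProperty f m T) {Ψ : opSystem f m →ₗ[ℂ] (H →L[ℂ] H)}
    (hΨ : ∀ g : opSystem f m, Tendsto (fun r : ℝ => compression (ampliation (Fock n) H)
      (kernel f m (scale r T)) (g : Fock n →L[ℂ] Fock n)) (𝓝[<] 1) (𝓝 (Ψ g))) :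
    CompletelyContractive Ψ := by
  intro k x
  refine norm_opMatrix_le_of_tendsto (ContinuousLinearMap.opNorm_nonneg _)
    (x := fun r i j => compression (ampliation (Fock n) H) (kernel f m (scale r T))
      (x i j : Fock n →L[ℂ] Fock n)) (fun i j => hΨ (x i j)) ?_
  filter_upwards [hT.eventually_isDilation hm] with r hr
  exact norm_opMatrix_compression_le hr.norm_map
    (fun i j => (x i j : Fock n →L[ℂ] Fock n))

/-- Each compression is multiplicative on the domain algebra, and multiplication is continuous in
norm, so the limit inherits it. -/
theorem HasRadialProperty.exists_algHom (hm : 1 ≤ m)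
    (hT : HasRadialProperty f m T) {Ψ : opSystem f m →ₗ[ℂ] (H →L[ℂ] H)}
    (hΨ : ∀ g : opSystem f m, Tendsto (fun r : ℝ => compression (ampliation (Fock n) H)
      (kernel f m (scale r T)) (g : Fock n →L[ℂ] Fock n)) (𝓝[<] 1) (𝓝 (Ψ g)))
    (h1 : Ψ ⟨1, one_mem_opSystem f m⟩ = 1) :
    ∃ φ : domainAlgebra f m →ₐ[ℂ] (H →L[ℂ] H), ∀ g : domainAlgebra f m,
      φ g = Ψ ⟨g, domainAlgebra_le_opSystem f m g.2⟩ := by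
  refine ⟨AlgHom.ofLinearMap
    { toFun := fun g => Ψ ⟨g, domainAlgebra_le_opSystem f m g.2⟩
      map_add' := fun g g' => Ψ.map_add ⟨g, domainAlgebra_le_opSystem f m g.2⟩
        ⟨g', domainAlgebra_le_opSystem f m g'.2⟩
      map_smul' := fun c g => Ψ.map_smul c ⟨g, domainAlgebra_le_opSystem f m g.2⟩ }
    h1 (fun g g' => ?_), fun g => rfl⟩
  refine tendsto_nhds_unique (hΨ ⟨(g * g' : domainAlgebra f m),
    domainAlgebra_le_opSystem f m (g * g').2⟩)
    (((hΨ ⟨g, domainAlgebra_le_opSystem f m g.2⟩).mul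
      (hΨ ⟨g', domainAlgebra_le_opSystem f m g'.2⟩)).congr' ?_)
  filter_upwards [hT.eventually_isDilation hm] with r hr
  exact (hr.compression_mul norm_ampliation_le g.2).symm

/-- Purity replaces `r < 1` in making the kernel of `T` an isometry. The compressions for rT minus
that for `T` are then uniformly bounded and tend to zero on the generators. -/
theorem HasRadialProperty.tendsto_compression_of_isPure (hm : 1 ≤ m)
    (hT : HasRadialProperty f m T) (hp : IsPure f T) {g : Fock n →L[ℂ] Fock n}
    (hg : g ∈ opSystem f m) :
    Tendsto (fun r : ℝ => compression (ampliation (Fock n) H) (kernel f m (scale r T)) g)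
      (𝓝[<] 1) (𝓝 (extBerezin f m T g)) := by
  have hK := isDilation_kernel hm hT.1
    (IsPure.tendsto_iterate_formMap zero_le_one (rowBound_of_mem_domain hm hT.1) hp)
  rw [extBerezin_eq_compression, tendsto_iff_norm_sub_tendsto_zero]
  have h : Tendsto (fun r : ℝ => (compression (ampliation (Fock n) H) (kernel f m (scale r T)) -
      compression (ampliation (Fock n) H) (kernel f m T)) g) (𝓝[<] 1) (𝓝 0) := by
    refine tendsto_zero_of_mem_closure_span (C := 2) two_pos ?_ ?_ hg
    · filter_upwards [hT.eventually_norm_compression_le hm] with r hr g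
      rw [LinearMap.sub_apply]
      refine (norm_sub_le _ _).trans ?_
      linarith [hr g, norm_compression_le norm_ampliation_le hK.norm_map g]
    · rintro _ ⟨⟨α, β⟩, rfl⟩
      have h1 := hT.tendsto_compression_mono hm α β
      rw [← hK.compression_mono] at h1
      exact tendsto_sub_nhds_zero_iff.2 h1
  have h2 := h.norm
  rwa [norm_zero] at h2

end Main

end NCDomain

end

theorem theorem2p7 {n m : ℕ} (hn : 1 ≤ n) (hm : 1 ≤ m)
    {H : Type*} [NormedAddCommGroup H] [InnerProductSpace ℂ H] [CompleteSpace H]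
    (f : NCDomain.PosRegular n) {ρ : ℝ} (hρ : 0 < ρ) (hf : f.IsFreeHolomorphicOn H ρ)
    (T : Fin n → H →L[ℂ] H) (hT : NCDomain.HasRadialProperty f m T) :
    (∀ᶠ r : ℝ in 𝓝[<] 1, NCDomain.BerezinDefined f m (NCDomain.scale r T)) ∧
    (∃ Ψ : NCDomain.opSystem f m →ₗ[ℂ] (H →L[ℂ] H),
      (∀ g : NCDomain.opSystem f m,
        Tendsto (fun r : ℝ => NCDomain.berezin f m (NCDomain.scale r T) g) (𝓝[<] 1) (𝓝 (Ψ g))) ∧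
      Ψ ⟨1, NCDomain.one_mem_opSystem f m⟩ = 1 ∧
      NCDomain.CompletelyContractive Ψ ∧
      (∀ α β : List (Fin n),
        Ψ ⟨NCDomain.mono (NCDomain.W f m) α * star (NCDomain.mono (NCDomain.W f m) β),
          NCDomain.mono_mem_opSystem f m α β⟩ = NCDomain.mono T α * star (NCDomain.mono T β)) ∧
      NCDomain.CompletelyContractive
        (Ψ ∘ₗ Submodule.inclusion (NCDomain.domainAlgebra_le_opSystem f m)) ∧
      (∃ φ : NCDomain.domainAlgebra f m →ₐ[ℂ] (H →L[ℂ] H), ∀ g : NCDomain.domainAlgebra f m,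
        φ g = Ψ ⟨g, NCDomain.domainAlgebra_le_opSystem f m g.2⟩)) ∧
    (NCDomain.IsPure f T →
      (∀ h : H, HasSum (fun α => NCDomain.kernelTerm f m T α h) (NCDomain.kernel f m T h)) ∧
      ∀ g ∈ NCDomain.opSystem f m,
        Tendsto (fun r : ℝ => NCDomain.berezin f m (NCDomain.scale r T) g) (𝓝[<] 1)
          (𝓝 (NCDomain.extBerezin f m T g))) := by
  obtain ⟨Ψ, hΨ⟩ := hT.exists_limit hm
  have hmono : ∀ α β : List (Fin n),
      Ψ ⟨NCDomain.mono (NCDomain.W f m) α * star (NCDomain.mono (NCDomain.W f m) β),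
        NCDomain.mono_mem_opSystem f m α β⟩ = NCDomain.mono T α * star (NCDomain.mono T β) :=
    fun α β => tendsto_nhds_unique (hΨ _) (hT.tendsto_compression_mono hm α β)
  have hone : Ψ ⟨1, NCDomain.one_mem_opSystem f m⟩ = 1 := by
    refine tendsto_nhds_unique (hΨ _) (tendsto_const_nhds.congr' ?_)
    filter_upwards [hT.eventually_isDilation hm] with r hr using hr.compression_one.symm
  have hcc := hT.completelyContractive_limit hm hΨ
  refine ⟨hT.eventually_berezinDefined hm,
    ⟨Ψ, fun g => (hΨ g).congr' (hT.eventually_berezin_eq hm g), hone, hcc, hmono,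
      fun k x => hcc k fun i j =>
        Submodule.inclusion (NCDomain.domainAlgebra_le_opSystem f m) (x i j),
      hT.exists_algHom hm hΨ hone⟩,
    fun hp => ⟨NCDomain.hasSum_kernel hm hT.1 (NCDomain.IsPure.tendsto_iterate_formMap zero_le_one
        (NCDomain.rowBound_of_mem_domain hm hT.1) hp), fun g hg => ?_⟩⟩
  exact (hT.tendsto_compression_of_isPure hm hp hg).congr' (hT.eventually_berezin_eq hm g)
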